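/- **Model.** There are $n$ nodes, at most $t<n/3$ of which are Byzantine (they behave arbitrarily and may collude). Communication is over a complete graph with authenticated channels and proceeds in synchronous rounds: a message sent in a round is received by the end of that round. Values are from a finite, totally ordered, non-empty set $\mathcal V$. The nodes execute $\ell$ instances of Byzantine consensus one after the other: each node $p$ starts instance $0$ at some round, and starts instance $k+1$ some number of rounds (possibly zero) after it has completed instance $k$; its inputs in the instances are arbitrary elements of $\mathcal V$ (they may depend on earlier outputs). Let $\Delta\ge 1$. Starts need not be synchronized; it is only assumed that any two non-faulty nodes that start the same instance do so at most $\Delta$ rounds apart. **Gradecast** with leader $q$, at node $p$, with a set $\mathrm{BAD}_p$ of nodes all of whose messages are ignored: (1) the leader $q$ sends its value to all; (2) $p$ sends the value received from $q$, if any, to all; (3) if the value received most often in (2) was received at least $n-t$ times, $p$ sends it to all. If the value $m$ received most often in (3) was received at least $n-t$ times, the result at $p$ is $m$ with confidence $2$; otherwise, if at least $t+1$ times, $m$ with confidence $1$; otherwise it is $\perp$ with confidence $0$. **ByzConsensus** at node $p$: set $v$ to the input. For $r=1,\dots,t+1$ (iteration $r$): all nodes gradecast their values $v$ in parallel; let $maj$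 be the value obtained most often with confidence at least $1$ (the lowest one in case of a tie), and let $c$ be the number of leaders from which $maj$ is obtained with confidence $2$; set $v:=maj$; add all leaders with confidence at most $1$ to $\mathrm{BAD}_p$; if $c\ge n-t$, break the loop. If the loop is broken in an iteration $r<t+1$, participate (send and relay, without changing $v$ and $\mathrm{BAD}_p$) in one more iteration. Then return $v$. **Updated ByzConsensus.** (a) $\mathrm{BAD}_p$ is initialized to $\emptyset$ only once for the whole sequence of instances. (b) Each round of ByzConsensus is stretched to $2\Delta+1$ rounds: its message, tagged with the instance and the stretched round, is sent in the first of them; the tagged messages received so far (one per sender and tag, the first to arrive) are evaluated at the end of the $(\Delta+1)$-st. (c) When ByzConsensus returns, $p$ sends "done" (tagged with the instance) to all nodes, and waits; if $p$ receives at least $t+1$ "done" messages (from distinct nodes) for its current instance, it also sends "done" to all; it sends "done" only once per instance. (d) If $p$ receives at least $2t+1$ "done" messages for its current instance, it completes the instance, with its current value $v$ as output. The "done" messages are not stretched. **Theorem.** There is an absolute constant $C$ such that for all $\mathcal V$, $n$, $t<n/3$, $\Delta\ge1$, $\ell$, and in every execution of the updated ByzConsensus algorithm as above with at most $t$ faulty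 nodes, all inputs, and any behaviour of the faulty nodes: 1. every non-faulty node completes all $\ell$ instances, with an output in each, within $C\cdot\Delta\cdot(\ell+t)$ rounds, not counting the rounds in which it is waiting to start an instance; 2. (agreement) in each instance all non-faulty nodes have the same output; 3. (validity) in each instance, if all non-faulty nodes have the same input $v$, then their output is $v$; 4. non-faulty nodes complete each instance within one round of each other. -/

import Mathlib

namespace ByzSeq

open Finset

/-! ### Counting votes -/

section Votes

variable {n : ℕ} {V : Type*} [LinearOrder V]

/-- The number of nodes whose entry in `f` is the value `x`
(`none` stands for "nothing received"). -/
def tally (f : Fin n → Option V) (x : V) : ℕ :=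
  (univ.filter fun s => f s = some x).card

variable [Fintype V] [Nonempty V]

/-- The values that occur most often in `f`. -/
def leaders (f : Fin n → Option V) : Finset V :=
  univ.filter fun x => ∀ y, tally f y ≤ tally f x

theorem leaders_nonempty (f : Fin n → Option V) : (leaders f).Nonempty := by
  obtain ⟨x, -, hx⟩ := Finset.exists_max_image (univ : Finset V) (tally f) univ_nonempty
  exact ⟨x, by simpa [leaders] using fun y => hx y (mem_univ y)⟩

/-- A value that occurs most often in `f`; among several such values, the lowest one. -/
def plurality (f : Fin n → Option V) : V :=
  (leaders f).min' (leaders_nonempty f)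

/-- What a node sends in the support round of a gradecast, given the echoes `f` it received:
the most frequent value if it occurs at least `n - t` times, nothing otherwise. -/
def support (t : ℕ) (f : Fin n → Option V) : Option V :=
  if n - t ≤ tally f (plurality f) then some (plurality f) else none

/-- The result (value, confidence) of a gradecast, given the supports `f` received. -/
def grade (t : ℕ) (f : Fin n → Option V) : Option V × ℕ :=
  if n - t ≤ tally f (plurality f) then (some (plurality f), 2)
  else if t + 1 ≤ tally f (plurality f) then (some (plurality f), 1)
  else (none, 0)

end Votes

/-! ### Messages and local states -/

/-- The contribution of one node to one of the three rounds of the `n` gradecasts that are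
executed in parallel: entry `q` belongs to the gradecast with leader `q`; `none` means that
nothing is sent for that gradecast. -/
abbrev Ballot (n : ℕ) (V : Type*) := Fin n → Option V

/-- Everything that one node sends to one other node in one physical round:
`proto k j` is the message (if any) for stretched round `j` of consensus instance `k`, and
`done k` tells whether a "done" message for instance `k` is sent. -/
structure Packet (n : ℕ) (V : Type*) where
  proto : ℕ → ℕ → Option (Ballot n V)
  done : ℕ → Bool

/-- The packet that contains no message. -/
def Packet.empty {n : ℕ} {V : Type*} : Packet n V := ⟨fun _ _ => none, fun _ => false⟩

/-- What a node is doing in a physical round. -/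
inductive Phase where
  /-- waiting for the start of the next instance, which happens in `w` rounds -/
  | idle (w : ℕ)
  /-- executing an instance that it started `age` rounds ago -/
  | active (age : ℕ)
  /-- all instances are completed -/
  | halted

/-- The local state of a node at the beginning of a physical round. -/
structure NodeState (n : ℕ) (V : Type*) where
  /-- the set `BAD`; it is initialised once for the entire sequence of instances -/
  bad : Finset (Fin n)
  /-- `log q k j`: the first message received from `q` for stretched round `j` of instance `k` -/
  log : Fin n → ℕ → ℕ → Option (Ballot n V)
  /-- `doneLog q k`: whether a "done" message for instance `k` was received from `q` -/
  doneLog : Fin n → ℕ → Bool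
  /-- the outputs of the instances completed so far -/
  output : ℕ → Option V
  /-- the current instance, which is also the number of instances completed so far -/
  inst : ℕ
  phase : Phase
  /-- the current value `v` of the current instance -/
  val : V
  /-- whether the main loop of the current instance has not been broken yet -/
  inLoop : Bool
  /-- the number of iterations, as known so far, after which the current instance returns -/
  last : ℕ
  /-- the message to be sent in the next stretched round -/
  next : Ballot n V
  /-- whether a "done" message was already sent for the current instance -/
  doneSent : Bool
  /-- what is sent to all nodes (the node itself included) in this physical round -/
  out : Packet n V

/-- The parameters known to all nodes: the bound `t` on the number of faulty nodes, the bound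
`Δ` on the difference of start times, and the number `ell` of instances. -/
structure Params where
  t : ℕ
  Δ : ℕ
  ell : ℕ

/-- The length of a stretched round, in physical rounds. The message of a stretched round is sent
in its first physical round; the received messages are evaluated after `Δ + 1` physical rounds,
when those of all nodes that start at most `Δ` later have arrived; the remaining `Δ` physical
rounds let all nodes that start at most `Δ` later do the same. -/
def Params.len (P : Params) : ℕ := 2 * P.Δ + 1

section Algorithm

variable {n : ℕ} {V : Type*} [LinearOrder V] [Fintype V] [Nonempty V]

/-- Receiving the packets of a physical round. -/
def NodeState.receive (s : NodeState n V) (inbox : Fin n → Packet n V) : NodeState n V :=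
  { s with
    log := fun q k j => (s.log q k j).or ((inbox q).proto k j)
    doneLog := fun q k => s.doneLog q k || (inbox q).done k
    out := Packet.empty }

/-- What was received from `sender` in stretched round `j` of the current instance for the
gradecast with leader `q`; all messages from nodes in `BAD` are ignored. -/
def NodeState.heard (s : NodeState n V) (j : ℕ) (q sender : Fin n) : Option V :=
  if sender ∈ s.bad then none else (s.log sender s.inst j).bind fun m => m q

/-- First round of the gradecast with leader `me`: the leader sends its value. -/
def valueMsg (me : Fin n) (v : V) : Ballot n V := fun q => if q = me then some v else none

/-- The result of the gradecast with leader `q` whose third round is stretched round `j`. -/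
def NodeState.graded (P : Params) (s : NodeState n V) (j : ℕ) (q : Fin n) : Option V × ℕ :=
  grade P.t (s.heard j q)

/-- The end of iteration `r` of the main loop, whose last stretched round is `j`: update the value
and the set `BAD`, and possibly break the loop. After breaking the loop in iteration `r < t + 1`
the node participates in one more iteration; no further iteration follows iteration `t + 1`. -/
def NodeState.endIteration (P : Params) (s : NodeState n V) (r j : ℕ) : NodeState n V :=
  let maj := plurality fun q => if 1 ≤ (s.graded P j q).2 then (s.graded P j q).1 else none
  let cnt := (univ.filter fun q => s.graded P j q = (some maj, 2)).card
  { s with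
    val := maj
    bad := s.bad ∪ univ.filter fun q => (s.graded P j q).2 ≤ 1
    inLoop := decide (cnt < n - P.t)
    last := if n - P.t ≤ cnt then min (r + 1) (P.t + 1) else s.last }

/-- Evaluating the messages of stretched round `j` of the current instance. Stretched rounds
`3 * i`, `3 * i + 1`, `3 * i + 2` are the three gradecast rounds of iteration `i + 1`. A node that
only participates in one more iteration relays messages but updates neither value nor `BAD`. -/
def NodeState.evaluate (P : Params) (me : Fin n) (s : NodeState n V) (j : ℕ) : NodeState n V :=
  if j % 3 = 0 then { s with next := fun q => s.heard j q q }
  else if j % 3 = 1 then { s with next := fun q => support P.t (s.heard j q) }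
  else
    let s' := if s.inLoop then s.endIteration P (j / 3 + 1) j else s
    { s' with next := valueMsg me s'.val }

/-- Starting the current instance with input `v`. -/
def NodeState.start (P : Params) (me : Fin n) (v : V) (s : NodeState n V) : NodeState n V :=
  { s with
    phase := Phase.active 0
    val := v
    inLoop := true
    last := P.t + 1
    doneSent := false
    out :=
      { s.out with
        proto := fun k j => if k = s.inst ∧ j = 0 then some (valueMsg me v) else none } }

/-- Going on to the instance `s.inst`, before whose start the node is idle for `w` rounds. -/
def NodeState.goOn (P : Params) (me : Fin n) (v : V) (w : ℕ) (s : NodeState n V) :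
    NodeState n V :=
  if P.ell ≤ s.inst then { s with phase := Phase.halted }
  else if w = 0 then s.start P me v
  else { s with phase := Phase.idle w }

/-- The state of node `me` in physical round `0`. Here `input k` is its input in instance `k`,
`gap 0` its waiting time before instance `0`, and `gap (k + 1)` its waiting time between
completing instance `k` and starting instance `k + 1`. -/
def initState (P : Params) (me : Fin n) (input : ℕ → V) (gap : ℕ → ℕ) : NodeState n V :=
  NodeState.goOn P me (input 0) (gap 0)
    { bad := ∅
      log := fun _ _ _ => none
      doneLog := fun _ _ => false
      output := fun _ => none
      inst := 0
      phase := Phase.halted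
      val := input 0
      inLoop := true
      last := P.t + 1
      next := fun _ => none
      doneSent := false
      out := Packet.empty }

/-- Completing the current instance: its output is the current value. -/
def NodeState.complete (P : Params) (me : Fin n) (input : ℕ → V) (gap : ℕ → ℕ)
    (s : NodeState n V) : NodeState n V :=
  NodeState.goOn P me (input (s.inst + 1)) (gap (s.inst + 1))
    { s with
      output := fun k => if k = s.inst then some s.val else s.output k
      inst := s.inst + 1
      out := { s.out with proto := fun _ _ => none } }

/-- One physical round of the algorithm at node `me`, which receives the packets `inbox`.

While an instance is executed, the node
* evaluates the messages of the current stretched round `Δ + 1` rounds after its beginning,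
* sends the next message at the beginning of the next stretched round,
* sends "done" (once) when `ByzConsensus` returns, or when it has received at least `t + 1`
  "done" messages,
* completes the instance when it has received at least `2 * t + 1` "done" messages. -/
def step (P : Params) (me : Fin n) (input : ℕ → V) (gap : ℕ → ℕ) (s₀ : NodeState n V)
    (inbox : Fin n → Packet n V) : NodeState n V :=
  let s := s₀.receive inbox
  match s.phase with
  | Phase.halted => s
  | Phase.idle w =>
    if w ≤ 1 then s.start P me (input s.inst) else { s with phase := Phase.idle (w - 1) }
  | Phase.active a =>
    let j := a / P.len
    let s' := if a % P.len = P.Δ ∧ j < 3 * s.last then s.evaluate P me j else s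
    let dones := (univ.filter fun q => s'.doneLog q s'.inst = true).card
    let tell := !s'.doneSent && (decide (3 * s'.last * P.len ≤ a + 1) || decide (P.t + 1 ≤ dones))
    let s'' : NodeState n V :=
      { s' with
        phase := Phase.active (a + 1)
        doneSent := s'.doneSent || tell
        out :=
          { proto := fun k i =>
              if k = s'.inst ∧ a + 1 = i * P.len ∧ i < 3 * s'.last then some s'.next else none
            done := fun k => tell && decide (k = s'.inst) } }
    if 2 * P.t + 1 ≤ dones then s''.complete P me input gap else s''

end Algorithm

/-! ### Executions -/

/-- All that determines an execution of the `n` nodes: the set of faulty nodes, the inputs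
(`input p k` for node `p` and instance `k`), the waiting times, and the behaviour of the faulty
nodes: in physical round `τ` a faulty node `q` sends the arbitrary packet `adv τ q p` to `p`. -/
structure Scenario (n : ℕ) (V : Type*) where
  faulty : Finset (Fin n)
  input : Fin n → ℕ → V
  gap : Fin n → ℕ → ℕ
  adv : ℕ → Fin n → Fin n → Packet n V

namespace Scenario

variable {n : ℕ} {V : Type*} [LinearOrder V] [Fintype V] [Nonempty V]

/-- The state of each node at the beginning of each physical round. In a physical round each node
sends its packets, and receives all packets sent to it in that round. (The states of faulty nodes
are meaningless.) -/
def run (P : Params) (σ : Scenario n V) : ℕ → Fin n → NodeState n V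
  | 0, p => initState P p (σ.input p) (σ.gap p)
  | τ + 1, p =>
    step P p (σ.input p) (σ.gap p) (run P σ τ p)
      fun q => if q ∈ σ.faulty then σ.adv τ q p else (run P σ τ q).out

/-- Node `p` starts instance `k` in physical round `τ`. -/
def StartsAt (P : Params) (σ : Scenario n V) (k : ℕ) (p : Fin n) (τ : ℕ) : Prop :=
  (σ.run P τ p).inst = k ∧ (σ.run P τ p).phase = Phase.active 0

/-- Node `p` completes instance `k` at the end of physical round `τ`. -/
def CompletesAt (P : Params) (σ : Scenario n V) (k : ℕ) (p : Fin n) (τ : ℕ) : Prop :=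
  (σ.run P τ p).inst = k ∧ (σ.run P (τ + 1) p).inst = k + 1

/-- Node `p` outputs `v` in instance `k`. -/
def Outputs (P : Params) (σ : Scenario n V) (k : ℕ) (p : Fin n) (v : V) : Prop :=
  ∃ τ, (σ.run P τ p).output k = some v

/-- Whenever two non-faulty nodes start the same instance, they do so at most `Δ` physical rounds
apart. -/
def StartSkewLE (P : Params) (σ : Scenario n V) : Prop :=
  ∀ k < P.ell, ∀ p ∉ σ.faulty, ∀ q ∉ σ.faulty, ∀ τ τ' : ℕ,
    σ.StartsAt P k p τ → σ.StartsAt P k q τ' → τ' ≤ τ + P.Δ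

/-- All non-faulty nodes output the same value in each of the instances. -/
def Agreement (P : Params) (σ : Scenario n V) : Prop :=
  ∀ k < P.ell, ∀ p ∉ σ.faulty, ∀ q ∉ σ.faulty, ∀ v w : V,
    σ.Outputs P k p v → σ.Outputs P k q w → v = w

/-- If all non-faulty nodes have the same input in an instance, then that is their output. -/
def Validity (P : Params) (σ : Scenario n V) : Prop :=
  ∀ k < P.ell, ∀ v : V, (∀ p ∉ σ.faulty, σ.input p k = v) →
    ∀ p ∉ σ.faulty, ∀ w : V, σ.Outputs P k p w → w = v

/-- Each non-faulty node executes all instances, with an output in each of them, within at most `T`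
physical rounds, not counting the rounds in which it is waiting for the start of an instance. -/
def TerminatesWithin (P : Params) (σ : Scenario n V) (T : ℕ) : Prop :=
  ∀ p ∉ σ.faulty, ∀ τ : ℕ, T + ∑ k ∈ range P.ell, σ.gap p k ≤ τ →
    (σ.run P τ p).phase = Phase.halted ∧ ∀ k < P.ell, ((σ.run P τ p).output k).isSome

/-- Non-faulty nodes complete each instance within one physical round of each other. -/
def CompletionSkewLEOne (P : Params) (σ : Scenario n V) : Prop :=
  ∀ k < P.ell, ∀ p ∉ σ.faulty, ∀ q ∉ σ.faulty, ∀ τ τ' : ℕ,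
    σ.CompletesAt P k p τ → σ.CompletesAt P k q τ' → τ' ≤ τ + 1

end Scenario

end ByzSeq

/-! A faulty gradecast leader must either look consistent or expose itself. If one correct node
obtains confidence 2, every correct node obtains the same value with confidence at least 1
(`GradecastSpec`). Suppose two correct nodes end an iteration with different majorities. Then some
leader not yet ignored by all of them got confidence at most 1 at every correct node, since
otherwise all would have counted identical votes; if all are still in the loop, all ignore that
leader from then on (`GradecastSpec.exists_suspect`). Correct leaders always get confidence 2, so at
most `t` nodes can be exposed, each only once. If some node breaks the loop, its `n - t` confident
votes impose its majority on everybody (`GradecastSpec.majority_eq_of_confident`), and one more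
iteration, now with unanimous values, lets the others break too (`Starts.settled_of_agree`).

As BAD survives from instance to instance, the number of nodes ignored by all correct nodes is a
potential bounded by `t`. An instance that settles after `R` iterations raises it by at least `R -
2`, so the total number of iterations telescopes to O(`ell + t`) (`exists_starts_completed`).

Stretching makes each message arrive before any correct node evaluates it, despite start times that
differ by up to `Δ` (`Starts.log_eq`). "Done" messages of faulty nodes alone reach no threshold, so
nobody is dragged out of an instance before all correct values are final (`Starts.quiet_succ`).
Conversely, `2t + 1` "done" messages at one node include `t + 1` from correct nodes; every correct
node still in the instance sees these and joins, so all complete one round later at the latest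
(`Settled.completion_skew`). -/

namespace ByzSeq

open Finset

/-! ### Votes of which at most `t` come from faulty nodes -/

section Counting

variable {n t : ℕ} {V : Type*} [LinearOrder V] {F : Finset (Fin n)}

theorem card_honest (hF : F.card ≤ t) : n - t ≤ (univ.filter fun s => s ∉ F).card := by
  have h : (univ.filter fun s => s ∉ F) = Fᶜ := by ext; simp
  rw [h, card_compl, Fintype.card_fin]
  omega

theorem exists_honest (hn : 3 * t < n) (hF : F.card ≤ t) : ∃ p, p ∉ F := by
  have h := card_honest hF
  obtain ⟨p, hp⟩ := card_pos.1 (show 0 < (univ.filter fun s => s ∉ F).card by omega)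
  exact ⟨p, by simpa using hp⟩

theorem exists_honest_of_tally (hF : F.card ≤ t) {f : Fin n → Option V} {x : V}
    (h : t + 1 ≤ tally f x) : ∃ s, s ∉ F ∧ f s = some x := by
  obtain ⟨s, hs, hsF⟩ := exists_mem_notMem_of_card_lt_card
    (show F.card < (univ.filter fun s => f s = some x).card from by
      unfold tally at h; omega)
  exact ⟨s, hsF, by simpa using hs⟩

theorem le_tally_of_honest (hF : F.card ≤ t) {f : Fin n → Option V} {x : V}
    (h : ∀ s, s ∉ F → f s = some x) : n - t ≤ tally f x := by
  refine (card_honest hF).trans (card_le_card fun s hs => ?_)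
  simpa using h s (by simpa using hs)

theorem tally_add_tally_le {f g : Fin n → Option V} {x y : V}
    (h : ∀ s, ¬ (f s = some x ∧ g s = some y)) : tally f x + tally g y ≤ n := by
  unfold tally
  rw [← card_union_of_disjoint]
  · simpa using card_le_univ (α := Fin n) _
  · rw [disjoint_left]
    intro s hs hs'
    exact h s ⟨by simpa using hs, by simpa using hs'⟩

/-- Discarding the faulty votes leaves at least `n - 2t ≥ t + 1`. This turns confidence 2 at one
node into confidence at least 1 at any other. -/
theorem succ_le_tally_of_agree (hn : 3 * t < n) (hF : F.card ≤ t) {f g : Fin n → Option V} {x : V}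
    (hfg : ∀ s, s ∉ F → f s = g s) (h : n - t ≤ tally f x) : t + 1 ≤ tally g x := by
  have h1 : tally f x ≤ tally g x + F.card := by
    refine le_trans (card_le_card fun s hs => ?_) (card_union_le _ _)
    by_cases hsF : s ∈ F
    · exact mem_union_right _ hsF
    · refine mem_union_left _ ?_
      have : f s = some x := by simpa using hs
      simpa [← hfg s hsF] using this
  omega

/-- Quorum intersection: two sets of `n - t` voters share at least `n - 2t > t` nodes, hence a
correct one, and that one votes identically in `f` and `g`. -/
theorem eq_of_large_tallies (hn : 3 * t < n) (hF : F.card ≤ t) {f g : Fin n → Option V} {x y : V}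
    (hfg : ∀ s, s ∉ F → f s = g s) (hx : n - t ≤ tally f x) (hy : n - t ≤ tally g y) : x = y := by
  have h1 : (univ : Finset (Fin n)).card ≤ n := by simp
  by_contra hxy
  have h2 : tally f x + tally g y ≤ n + F.card := by
    unfold tally
    rw [← card_union_add_card_inter]
    refine add_le_add ((card_le_univ _).trans h1) (card_le_card fun s hs => ?_)
    by_contra hsF
    simp only [mem_inter, mem_filter, mem_univ, true_and] at hs
    exact hxy (by simpa [hs.1, hs.2] using hfg s hsF)
  omega

variable [Fintype V] [Nonempty V]

theorem tally_le_plurality (f : Fin n → Option V) (y : V) : tally f y ≤ tally f (plurality f) := by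
  have h := (leaders f).min'_mem (leaders_nonempty f)
  simp only [leaders, mem_filter, mem_univ, true_and] at h
  exact h y

/-- Two distinct values with `n - t` votes each would need `2(n - t) > n` voters, so a quorum value
is the unique most frequent one and the tie-break plays no role. -/
theorem plurality_eq (hn : 3 * t < n) {f : Fin n → Option V} {x : V} (h : n - t ≤ tally f x) :
    plurality f = x := by
  by_contra hne
  have h1 := tally_le_plurality f x
  have h2 : tally f (plurality f) + tally f x ≤ n :=
    tally_add_tally_le fun s hs => hne (by simpa [hs.1] using hs.2)
  omega

theorem support_eq_of_large (hn : 3 * t < n) {f : Fin n → Option V} {x : V}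
    (h : n - t ≤ tally f x) : support t f = some x := by
  rw [support, plurality_eq hn h, if_pos h]

theorem large_of_support_eq {f : Fin n → Option V} {x : V} (h : support t f = some x) :
    n - t ≤ tally f x := by
  unfold support at h
  split_ifs at h with h1
  simpa [Option.some.inj h] using h1

theorem grade_eq_of_large (hn : 3 * t < n) {f : Fin n → Option V} {x : V}
    (h : n - t ≤ tally f x) : grade t f = (some x, 2) := by
  rw [grade, plurality_eq hn h, if_pos h]

theorem exists_of_one_le_grade (hn : 3 * t < n) {f : Fin n → Option V} (h : 1 ≤ (grade t f).2) :
    ∃ x, (grade t f).1 = some x ∧ t + 1 ≤ tally f x := by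
  unfold grade at h ⊢
  split_ifs at h ⊢ with h1 h2
  · exact ⟨_, rfl, by omega⟩
  · exact ⟨_, rfl, h2⟩
  · simp at h

theorem exists_of_two_le_grade {f : Fin n → Option V} (h : 2 ≤ (grade t f).2) :
    ∃ x, (grade t f).1 = some x ∧ n - t ≤ tally f x := by
  unfold grade at h ⊢
  split_ifs at h ⊢ with h1 h2
  · exact ⟨_, rfl, h1⟩
  · simp at h
  · simp at h

theorem one_le_grade_of_tally {f : Fin n → Option V} {x : V} (h : t + 1 ≤ tally f x) :
    1 ≤ (grade t f).2 := by
  have h1 := tally_le_plurality f x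
  unfold grade
  split_ifs with h2 h3
  · simp
  · simp
  · omega

/-- Two gradecast results with positive confidence have the same value, provided that the
supports of the non-faulty nodes do not contradict each other. -/
theorem grade_value_eq (hn : 3 * t < n) (hF : F.card ≤ t) {f g : Fin n → Option V}
    (hfg : ∀ s, s ∉ F → ∀ s', s' ∉ F → ∀ x y, f s = some x → g s' = some y → x = y)
    (h1 : 1 ≤ (grade t f).2) (h2 : 1 ≤ (grade t g).2) : (grade t g).1 = (grade t f).1 := by
  obtain ⟨x, hx, hx'⟩ := exists_of_one_le_grade hn h1
  obtain ⟨y, hy, hy'⟩ := exists_of_one_le_grade hn h2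
  obtain ⟨s, hs, hsx⟩ := exists_honest_of_tally hF hx'
  obtain ⟨s', hs', hsy⟩ := exists_honest_of_tally hF hy'
  rw [hx, hy, hfg s hs s' hs' x y hsx hsy]

end Counting

/-! ### One iteration of the main loop -/

section Iteration

variable {n t : ℕ} {V : Type*} [LinearOrder V] [Fintype V] [Nonempty V] {F : Finset (Fin n)}

/-- The properties of the results `g p q` of the parallel gradecasts (at node `p`, with leader `q`)
when the leaders have the values `v` and node `p` ignores the messages of the nodes in `B p`. -/
structure GradecastSpec (F : Finset (Fin n)) (B : Fin n → Finset (Fin n)) (v : Fin n → V)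
    (g : Fin n → Fin n → Option V × ℕ) : Prop where
  honest : ∀ p, p ∉ F → ∀ q, q ∉ F → g p q = (some (v q), 2)
  value_eq : ∀ p, p ∉ F → ∀ p', p' ∉ F → ∀ q, 1 ≤ (g p q).2 → 1 ≤ (g p' q).2 →
    (g p' q).1 = (g p q).1
  close : ∀ p, p ∉ F → ∀ p', p' ∉ F → ∀ q, 2 ≤ (g p q).2 → 1 ≤ (g p' q).2
  ignored : ∀ q, (∀ p, p ∉ F → q ∈ B p) → ∀ p, p ∉ F → (g p q).2 = 0

/-- Three rounds of message exchange among the non-faulty nodes realise the gradecasts. Here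
`h₀`, `h₁`, `h₂` are the values heard in the three rounds: by node `p`, for the gradecast with
leader `q`, from node `s`. -/
theorem gradecastSpec_of_rounds (hn : 3 * t < n) (hF : F.card ≤ t) {B : Fin n → Finset (Fin n)}
    {v : Fin n → V} {h₀ h₁ h₂ : Fin n → Fin n → Fin n → Option V}
    (H₀ : ∀ p, p ∉ F → ∀ q, q ∉ F → h₀ p q q = some (v q))
    (H₁ : ∀ p, p ∉ F → ∀ s, s ∉ F → ∀ q, h₁ p q s = h₀ s q q)
    (H₂ : ∀ p, p ∉ F → ∀ s, s ∉ F → ∀ q, h₂ p q s = support t (h₁ s q))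
    (HB : ∀ p, p ∉ F → ∀ q, q ∈ B p → h₀ p q q = none) :
    GradecastSpec F B v fun p q => grade t (h₂ p q) := by
  -- Correct supports never conflict: each rests on a quorum of echoes, and a correct node echoes
  -- the same value to everybody.
  have cons : ∀ p, p ∉ F → ∀ p', p' ∉ F → ∀ q s, s ∉ F → ∀ s', s' ∉ F → ∀ x y,
      h₂ p q s = some x → h₂ p' q s' = some y → x = y := by
    intro p hp p' hp' q s hs s' hs' x y hx hy
    rw [H₂ p hp s hs] at hx
    rw [H₂ p' hp' s' hs'] at hy
    refine eq_of_large_tallies hn hF (fun u hu => ?_) (large_of_support_eq hx)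
      (large_of_support_eq hy)
    rw [H₁ s hs u hu, H₁ s' hs' u hu]
  refine ⟨fun p hp q hq => ?_, fun p hp p' hp' q h1 h2 => ?_, fun p hp p' hp' q h => ?_,
    fun q hq p hp => ?_⟩
  · refine grade_eq_of_large hn (le_tally_of_honest hF fun s hs => ?_)
    rw [H₂ p hp s hs]
    refine support_eq_of_large hn (le_tally_of_honest hF fun u hu => ?_)
    rw [H₁ s hs u hu, H₀ u hu q hq]
  · exact grade_value_eq hn hF (cons p hp p' hp' q) h1 h2
  · obtain ⟨x, -, hx⟩ := exists_of_two_le_grade h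
    exact one_le_grade_of_tally (succ_le_tally_of_agree hn hF
      (fun s hs => by rw [H₂ p hp s hs, H₂ p' hp' s hs]) hx)
  -- Positive confidence is traced back to a correct supporter and from there to a correct echoer,
  -- which would have had to listen to the ignored leader.
  · by_contra hne
    obtain ⟨x, -, hx⟩ := exists_of_one_le_grade hn (Nat.one_le_iff_ne_zero.2 hne)
    obtain ⟨s, hs, hsx⟩ := exists_honest_of_tally hF hx
    rw [H₂ p hp s hs] at hsx
    obtain ⟨u, hu, hux⟩ := exists_honest_of_tally (x := x) (f := h₁ s q) hF (by
      have := large_of_support_eq hsx; omega)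
    rw [H₁ s hs u hu, HB u hu q (hq u hu)] at hux
    cases hux

/-- The value obtained most often with confidence at least `1`. -/
def majority (g : Fin n → Option V × ℕ) : V :=
  plurality fun q => if 1 ≤ (g q).2 then (g q).1 else none

/-- The number of leaders from which the majority value is obtained with confidence `2`. -/
def confident (g : Fin n → Option V × ℕ) : ℕ :=
  (univ.filter fun q => g q = (some (majority g), 2)).card

/-- The leaders with confidence at most `1`. -/
def suspects (g : Fin n → Option V × ℕ) : Finset (Fin n) :=
  univ.filter fun q => (g q).2 ≤ 1

namespace GradecastSpec

variable {B : Fin n → Finset (Fin n)} {v : Fin n → V} {g : Fin n → Fin n → Option V × ℕ}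

-- Correct leaders always get confidence 2. Hence BAD never contains a correct node, and the quorum
-- arguments remain valid while messages are being ignored.
omit [LinearOrder V] [Fintype V] [Nonempty V] in
theorem suspects_subset (h : GradecastSpec F B v g) {p : Fin n} (hp : p ∉ F) :
    suspects (g p) ⊆ F := by
  intro q hq
  by_contra hqF
  simp [suspects, h.honest p hp q hqF] at hq

theorem majority_eq_of_forall (h : GradecastSpec F B v g) (hn : 3 * t < n) (hF : F.card ≤ t)
    {x : V} (hx : ∀ q, q ∉ F → v q = x) {p : Fin n} (hp : p ∉ F) : majority (g p) = x := by
  refine plurality_eq hn (le_tally_of_honest hF fun q hq => ?_)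
  simp [h.honest p hp q hq, hx q hq]

theorem confident_of_forall (h : GradecastSpec F B v g) (hn : 3 * t < n) (hF : F.card ≤ t)
    {x : V} (hx : ∀ q, q ∉ F → v q = x) {p : Fin n} (hp : p ∉ F) : n - t ≤ confident (g p) := by
  rw [confident, h.majority_eq_of_forall hn hF hx hp]
  refine (card_honest hF).trans (card_le_card fun q hq => ?_)
  have hq : q ∉ F := by simpa using hq
  simp [h.honest p hp q hq, hx q hq]

/-- Each of the `n - t` leaders graded 2 at `p` yields the same value with confidence at least 1 at
`p'`, so they form a quorum there too. -/
theorem majority_eq_of_confident (h : GradecastSpec F B v g) (hn : 3 * t < n) {p p' : Fin n}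
    (hp : p ∉ F) (hp' : p' ∉ F) (hc : n - t ≤ confident (g p)) :
    majority (g p') = majority (g p) := by
  refine plurality_eq hn (hc.trans (card_le_card fun q hq => ?_))
  have hq : g p q = (some (majority (g p)), 2) := by simpa using hq
  have h1 := h.close p hp p' hp' q (by simp [hq])
  have h2 := h.value_eq p hp p' hp' q (by simp [hq]) h1
  simp [h1, h2, hq]

/-- If two non-faulty nodes end an iteration with different values, then some node that is not yet
ignored by all non-faulty nodes is detected by all of them. -/
theorem exists_suspect (h : GradecastSpec F B v g) {p p' : Fin n} (hp : p ∉ F) (hp' : p' ∉ F)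
    (hne : majority (g p) ≠ majority (g p')) :
    ∃ q, (¬ ∀ u, u ∉ F → q ∈ B u) ∧ ∀ u, u ∉ F → q ∈ suspects (g u) := by
  -- If no such leader exists, the votes of `p` and `p'` coincide entry by entry: a commonly ignored
  -- leader counts for neither, and any other leader has confidence 2 at some correct `u`, hence the
  -- same value at both.
  by_contra! hcon
  refine hne (congrArg plurality (funext fun q => ?_))
  by_cases hB : ∀ u, u ∉ F → q ∈ B u
  · simp [h.ignored q hB p hp, h.ignored q hB p' hp']
  · obtain ⟨u, hu, hqu⟩ := hcon q (by simpa using hB)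
    have h2 : 2 ≤ (g u q).2 := by
      simp only [suspects, mem_filter, mem_univ, true_and] at hqu; omega
    have h3 := h.close u hu p hp q h2
    have h4 := h.close u hu p' hp' q h2
    simp [h3, h4, h.value_eq p hp p' hp' q h3 h4]

end GradecastSpec

end Iteration

/-! ### One physical round at one node -/

section Local

variable {n : ℕ} {V : Type*} [LinearOrder V] [Fintype V] [Nonempty V]
  {P : Params} {me : Fin n} {input : ℕ → V} {gap : ℕ → ℕ} {s : NodeState n V}
  {inbox : Fin n → Packet n V}

namespace NodeState

/-- The components of the state that only the evaluation of messages changes within an instance. -/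
def core (s : NodeState n V) : (Finset (Fin n) × V) × (Bool × ℕ) × Ballot n V :=
  ((s.bad, s.val), (s.inLoop, s.last), s.next)

/-- The evaluation, if any, at age `a`. -/
def evaluateAt (P : Params) (me : Fin n) (s : NodeState n V) (a : ℕ) : NodeState n V :=
  if a % P.len = P.Δ ∧ a / P.len < 3 * s.last then s.evaluate P me (a / P.len) else s

/-- The number of nodes from which "done" was received for the current instance. -/
def doneCount (s : NodeState n V) : ℕ :=
  (univ.filter fun q => s.doneLog q s.inst = true).card

/-- Whether a "done" message is to be sent at the end of the round of age `a`. -/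
def tell (P : Params) (s : NodeState n V) (a : ℕ) : Bool :=
  !s.doneSent && (decide (3 * s.last * P.len ≤ a + 1) || decide (P.t + 1 ≤ s.doneCount))

/-- The end of the round of age `a`, before the instance is possibly completed. -/
def advance (P : Params) (s : NodeState n V) (a : ℕ) : NodeState n V :=
  { s with
    phase := Phase.active (a + 1)
    doneSent := s.doneSent || s.tell P a
    out :=
      { proto := fun k i =>
          if k = s.inst ∧ a + 1 = i * P.len ∧ i < 3 * s.last then some s.next else none
        done := fun k => s.tell P a && decide (k = s.inst) } }

theorem evaluate_frame (j : ℕ) :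
    (s.evaluate P me j).log = s.log ∧ (s.evaluate P me j).doneLog = s.doneLog ∧
    (s.evaluate P me j).output = s.output ∧ (s.evaluate P me j).inst = s.inst ∧
    (s.evaluate P me j).phase = s.phase ∧ (s.evaluate P me j).doneSent = s.doneSent ∧
    (s.evaluate P me j).out = s.out := by
  unfold evaluate endIteration
  dsimp only
  split_ifs <;> simp

theorem evaluateAt_frame (a : ℕ) :
    (s.evaluateAt P me a).log = s.log ∧ (s.evaluateAt P me a).doneLog = s.doneLog ∧
    (s.evaluateAt P me a).output = s.output ∧ (s.evaluateAt P me a).inst = s.inst ∧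
    (s.evaluateAt P me a).phase = s.phase ∧ (s.evaluateAt P me a).doneSent = s.doneSent ∧
    (s.evaluateAt P me a).out = s.out := by
  unfold evaluateAt
  split_ifs
  · exact evaluate_frame _
  · simp

theorem doneCount_evaluateAt (a : ℕ) : (s.evaluateAt P me a).doneCount = s.doneCount := by
  unfold doneCount
  rw [(evaluateAt_frame a).2.1, (evaluateAt_frame a).2.2.2.1]

/-- The properties of a state in which an instance is just being started. -/
structure Fresh (P : Params) (me : Fin n) (input : ℕ → V) (s : NodeState n V) : Prop where
  val : s.val = input s.inst
  inLoop : s.inLoop = true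
  last : s.last = P.t + 1
  doneSent : s.doneSent = false
  out : ∀ k j, s.out.proto k j = if k = s.inst ∧ j = 0 then some (valueMsg me s.val) else none

omit [LinearOrder V] [Fintype V] [Nonempty V] in
theorem fresh_start : (s.start P me (input s.inst)).Fresh P me input :=
  ⟨rfl, rfl, rfl, rfl, fun _ _ => rfl⟩

omit [LinearOrder V] [Fintype V] [Nonempty V] in
/-- The ways in which `goOn` can leave a state. -/
theorem goOn_cases {w : ℕ} :
    (P.ell ≤ s.inst ∧ s.goOn P me (input s.inst) w = { s with phase := Phase.halted }) ∨
    (s.inst < P.ell ∧ w = 0 ∧ s.goOn P me (input s.inst) w = s.start P me (input s.inst)) ∨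
    (s.inst < P.ell ∧ w ≠ 0 ∧ s.goOn P me (input s.inst) w = { s with phase := Phase.idle w }) := by
  unfold goOn
  split_ifs <;> simp_all

omit [LinearOrder V] [Fintype V] [Nonempty V] in
theorem goOn_frame {v : V} {w : ℕ} :
    (s.goOn P me v w).log = s.log ∧ (s.goOn P me v w).doneLog = s.doneLog ∧
    (s.goOn P me v w).output = s.output ∧ (s.goOn P me v w).inst = s.inst ∧
    (s.goOn P me v w).bad = s.bad ∧ (s.goOn P me v w).out.done = s.out.done := by
  unfold goOn start
  split_ifs <;> simp

end NodeState

open NodeState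

/-! ### Case analysis of one step and preservation of the local invariants -/

theorem step_halted (h : s.phase = Phase.halted) :
    step P me input gap s inbox = s.receive inbox := by
  simp [step, receive, h]

theorem step_idle {w : ℕ} (h : s.phase = Phase.idle w) :
    step P me input gap s inbox =
      if w ≤ 1 then (s.receive inbox).start P me (input s.inst)
      else { s.receive inbox with phase := Phase.idle (w - 1) } := by
  simp [step, receive, h]

theorem step_active {a : ℕ} (h : s.phase = Phase.active a) :
    step P me input gap s inbox =
      if 2 * P.t + 1 ≤ (s.receive inbox).doneCount then
        (((s.receive inbox).evaluateAt P me a).advance P a).complete P me input gap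
      else ((s.receive inbox).evaluateAt P me a).advance P a := by
  rw [← doneCount_evaluateAt (P := P) (me := me) a]
  have h' : (s.receive inbox).phase = Phase.active a := h
  unfold step
  simp only [h']
  rfl

theorem step_log : (step P me input gap s inbox).log =
    fun q k j => (s.log q k j).or ((inbox q).proto k j) := by
  rcases h : s.phase with w | a | _
  · rw [step_idle h]; split_ifs <;> rfl
  · have key : (((s.receive inbox).evaluateAt P me a).advance P a).log =
        fun q k j => (s.log q k j).or ((inbox q).proto k j) :=
      (evaluateAt_frame a).1
    rw [step_active h]
    split_ifs
    · exact goOn_frame.1.trans key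
    · exact key
  · rw [step_halted h]; rfl

theorem step_doneLog : (step P me input gap s inbox).doneLog =
    fun q k => s.doneLog q k || (inbox q).done k := by
  rcases h : s.phase with w | a | _
  · rw [step_idle h]; split_ifs <;> rfl
  · have key : (((s.receive inbox).evaluateAt P me a).advance P a).doneLog =
        fun q k => s.doneLog q k || (inbox q).done k :=
      (evaluateAt_frame a).2.1
    rw [step_active h]
    split_ifs
    · exact goOn_frame.2.1.trans key
    · exact key
  · rw [step_halted h]; rfl

omit [LinearOrder V] [Fintype V] [Nonempty V] in
theorem complete_frame :
    (s.complete P me input gap).output = (fun k => if k = s.inst then some s.val else s.output k) ∧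
    (s.complete P me input gap).inst = s.inst + 1 ∧
    (s.complete P me input gap).bad = s.bad ∧
    (s.complete P me input gap).out.done = s.out.done := by
  obtain ⟨-, -, h1, h2, h3, h4⟩ := goOn_frame (P := P) (me := me) (v := input (s.inst + 1))
    (w := gap (s.inst + 1)) (s := { s with
      output := fun k => if k = s.inst then some s.val else s.output k
      inst := s.inst + 1
      out := { s.out with proto := fun _ _ => none } })
  exact ⟨h1, h2, h3, h4⟩

/-- A round in which the current instance is not completed. -/
theorem step_active_stay {a : ℕ} (h : s.phase = Phase.active a)
    (hi : (step P me input gap s inbox).inst = s.inst) :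
    (s.receive inbox).doneCount ≤ 2 * P.t ∧
      step P me input gap s inbox = ((s.receive inbox).evaluateAt P me a).advance P a := by
  rw [step_active h] at hi ⊢
  split_ifs at hi ⊢ with h1
  · rw [complete_frame.2.1] at hi
    have : (((s.receive inbox).evaluateAt P me a).advance P a).inst = s.inst :=
      (evaluateAt_frame a).2.2.2.1
    omega
  · exact ⟨by omega, rfl⟩

/-- A round in which the current instance is completed. -/
theorem step_active_leave {a : ℕ} (h : s.phase = Phase.active a)
    (hi : (step P me input gap s inbox).inst ≠ s.inst) :
    2 * P.t + 1 ≤ (s.receive inbox).doneCount ∧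
      step P me input gap s inbox =
        (((s.receive inbox).evaluateAt P me a).advance P a).complete P me input gap := by
  rw [step_active h] at hi ⊢
  split_ifs at hi ⊢ with h1
  · exact ⟨h1, rfl⟩
  · exact absurd (evaluateAt_frame a).2.2.2.1 hi

theorem step_inst_of_count {a : ℕ} (h : s.phase = Phase.active a) :
    (step P me input gap s inbox).inst =
      if 2 * P.t + 1 ≤ (s.receive inbox).doneCount then s.inst + 1 else s.inst := by
  have : (((s.receive inbox).evaluateAt P me a).advance P a).inst = s.inst :=
    (evaluateAt_frame a).2.2.2.1
  rw [step_active h]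
  split_ifs
  · rw [complete_frame.2.1, this]
  · exact this

theorem step_inst_of_not_active (h : ∀ a, s.phase ≠ Phase.active a) :
    (step P me input gap s inbox).inst = s.inst := by
  rcases h' : s.phase with w | a | _
  · rw [step_idle h']; split_ifs <;> rfl
  · exact absurd h' (h a)
  · rw [step_halted h']; rfl

/-- The invariants of the state of a node. -/
structure NodeState.Inv (P : Params) (me : Fin n) (input : ℕ → V) (s : NodeState n V) : Prop where
  halted_iff : s.phase = Phase.halted ↔ P.ell ≤ s.inst
  fresh : s.phase = Phase.active 0 → s.Fresh P me input
  proto : ∀ a, s.phase = Phase.active (a + 1) → ∀ k i, s.out.proto k i =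
    if k = s.inst ∧ a + 1 = i * P.len ∧ i < 3 * s.last then some s.next else none
  proto_idle : (∀ a, s.phase ≠ Phase.active a) → ∀ k i, s.out.proto k i = none
  done : ∀ a, s.phase = Phase.active (a + 1) → 3 * s.last * P.len ≤ a + 1 → s.doneSent = true
  last_le : (∃ a, s.phase = Phase.active a) → s.last ≤ P.t + 1
  idle_pos : ∀ w, s.phase = Phase.idle w → w ≠ 0
  output : ∀ k, s.inst ≤ k → s.output k = none

theorem evaluate_last_le (h : s.last ≤ P.t + 1) (j : ℕ) :
    (s.evaluate P me j).last ≤ P.t + 1 := by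
  unfold evaluate endIteration
  dsimp only
  split_ifs <;> simp [h]

omit [LinearOrder V] [Fintype V] [Nonempty V] in
theorem NodeState.Inv.start (hi : s.inst < P.ell) (ho : ∀ k, s.inst ≤ k → s.output k = none) :
    (s.start P me (input s.inst)).Inv P me input where
  halted_iff := by simpa [NodeState.start] using hi
  fresh _ := fresh_start
  proto a h := by simp [NodeState.start] at h
  proto_idle h := absurd rfl (h 0)
  done a h := by simp [NodeState.start] at h
  last_le _ := le_rfl
  idle_pos w h := by simp [NodeState.start] at h
  output := ho

omit [LinearOrder V] [Fintype V] [Nonempty V] in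
theorem NodeState.Inv.goOn {w : ℕ} (ho : ∀ k, s.inst ≤ k → s.output k = none)
    (hp : ∀ k i, s.out.proto k i = none) :
    (s.goOn P me (input s.inst) w).Inv P me input := by
  rcases goOn_cases (P := P) (me := me) (input := input) (s := s) (w := w) with
    ⟨h, e⟩ | ⟨h, -, e⟩ | ⟨h, hw, e⟩ <;> rw [e]
  · exact ⟨by simpa using h, by simp, by simp, fun _ => hp, by simp, by simp, by simp, ho⟩
  · exact .start h ho
  · exact ⟨by simpa using h, by simp, by simp, fun _ => hp, by simp, by simp,
      fun w' h' => by cases h'; exact hw, ho⟩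

omit [LinearOrder V] [Fintype V] [Nonempty V] in
theorem NodeState.Inv.init : (initState P me input gap).Inv P me input :=
  NodeState.Inv.goOn (s := { (⟨∅, fun _ _ _ => none, fun _ _ => false, fun _ => none, 0,
    Phase.halted, input 0, true, P.t + 1, fun _ => none, false, Packet.empty⟩ :
    NodeState n V) with }) (fun _ _ => rfl) fun _ _ => rfl

theorem NodeState.Inv.step (h : s.Inv P me input) :
    (step P me input gap s inbox).Inv P me input := by
  rcases h' : s.phase with w | a | _
  · rw [step_idle h']
    have hell : s.inst < P.ell := by
      by_contra hc
      have := h.halted_iff.2 (by omega)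
      simp [h'] at this
    split_ifs with hw
    · exact .start (s := s.receive inbox) hell h.output
    · exact ⟨by simpa [receive] using hell, by simp, by simp, fun _ _ _ => rfl, by simp, by simp,
        fun w' e => by cases e; omega, h.output⟩
  · have hell : s.inst < P.ell := by
      by_contra hc
      have := h.halted_iff.2 (by omega)
      simp [h'] at this
    have hfr := evaluateAt_frame (P := P) (me := me) (s := s.receive inbox) a
    rw [step_active h']
    split_ifs
    · refine NodeState.Inv.goOn (s := { ((s.receive inbox).evaluateAt P me a).advance P a with
        output := _, inst := _, out := _ }) ?_ fun _ _ => rfl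
      intro k hk
      have hk : ((s.receive inbox).evaluateAt P me a).inst + 1 ≤ k := hk
      have e : ((s.receive inbox).evaluateAt P me a).inst ≠ k := by omega
      have : ((s.receive inbox).evaluateAt P me a).output k = none := by
        rw [hfr.2.2.1]
        rw [hfr.2.2.2.1] at hk
        exact h.output k (by change s.inst + 1 ≤ k at hk; omega)
      simpa [advance, e.symm] using this
    · refine ⟨?_, fun e => ?_, fun b e => ?_, fun e => absurd rfl (e (a + 1)), fun b e => ?_,
        fun _ => ?_, fun w e => ?_, fun k hk => ?_⟩
      · have : ((s.receive inbox).evaluateAt P me a).inst = s.inst := hfr.2.2.2.1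
        simpa [advance, this] using hell
      · simp [advance] at e
      · simp only [advance, Phase.active.injEq, Nat.add_right_cancel_iff] at e
        subst e
        exact fun _ _ => rfl
      · simp only [advance, Phase.active.injEq, Nat.add_right_cancel_iff] at e
        subst e
        intro hl
        have hl : 3 * ((s.receive inbox).evaluateAt P me a).last * P.len ≤ a + 1 := hl
        simp [advance, tell, hl]
      · have hl := h.last_le ⟨a, h'⟩
        change ((s.receive inbox).evaluateAt P me a).last ≤ P.t + 1
        unfold evaluateAt
        split_ifs
        · exact evaluate_last_le (s := s.receive inbox) hl _
        · exact hl
      · simp [advance] at e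
      · change ((s.receive inbox).evaluateAt P me a).output k = none
        have hk : ((s.receive inbox).evaluateAt P me a).inst ≤ k := hk
        rw [hfr.2.2.1]
        exact h.output k (hfr.2.2.2.1 ▸ hk)
  · rw [step_halted h']
    have := h.halted_iff.1 h'
    exact ⟨by simpa [receive, h'] using this, by simp [receive, h'], by simp [receive, h'],
      fun _ _ _ => rfl, by simp [receive, h'], by simp [receive, h'], by simp [receive, h'],
      h.output⟩

/-- In the extra iteration after breaking the loop only the message to be relayed changes. -/
theorem evaluate_core_of_frozen {j : ℕ} (h : s.inLoop = false) :
    (s.evaluate P me j).val = s.val ∧ (s.evaluate P me j).bad = s.bad ∧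
    (s.evaluate P me j).inLoop = s.inLoop ∧ (s.evaluate P me j).last = s.last := by
  unfold evaluate
  split_ifs <;> simp_all

/-- The effect of the evaluation in the first round of a gradecast. -/
theorem evaluate_zero {i : ℕ} : s.evaluate P me (3 * i) =
    { s with next := fun q => s.heard (3 * i) q q } := by
  simp [evaluate]

theorem evaluate_one {i : ℕ} : s.evaluate P me (3 * i + 1) =
    { s with next := fun q => support P.t (s.heard (3 * i + 1) q) } := by
  have h : (3 * i + 1) % 3 = 1 := by omega
  simp [evaluate, h]

theorem evaluate_two {i : ℕ} : s.evaluate P me (3 * i + 2) =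
    if s.inLoop then
      { s.endIteration P (i + 1) (3 * i + 2) with
        next := valueMsg me (s.endIteration P (i + 1) (3 * i + 2)).val }
    else { s with next := valueMsg me s.val } := by
  have h : (3 * i + 2) % 3 = 2 := by omega
  have h' : (3 * i + 2) / 3 = i := by omega
  simp only [evaluate, h, h']
  by_cases hl : s.inLoop <;> simp [hl]

theorem endIteration_eq {r j : ℕ} {g : Fin n → Option V × ℕ}
    (hg : ∀ q, s.graded P j q = g q) : s.endIteration P r j =
      { s with
        val := majority g
        bad := s.bad ∪ suspects g
        inLoop := decide (confident g < n - P.t)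
        last := if n - P.t ≤ confident g then min (r + 1) (P.t + 1) else s.last } := by
  have : s.graded P j = g := funext hg
  subst this
  rfl

end Local

/-! ### Consequences for executions -/

section StepPhase

variable {n : ℕ} {V : Type*} [LinearOrder V] [Fintype V] [Nonempty V]
  {P : Params} {me : Fin n} {input : ℕ → V} {gap : ℕ → ℕ} {s : NodeState n V}
  {inbox : Fin n → Packet n V}

open NodeState

omit [LinearOrder V] [Fintype V] [Nonempty V] in
theorem phase_goOn_ne {v : V} {w a : ℕ} :
    (s.goOn P me v w).phase ≠ Phase.active (a + 1) := by
  unfold goOn NodeState.start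
  split_ifs <;> simp

/-- A positive age has only one possible predecessor, which allows tracing an active node back to
the round in which it started the instance. -/
theorem step_phase_succ {a : ℕ} (h : (step P me input gap s inbox).phase = Phase.active (a + 1)) :
    s.phase = Phase.active a ∧ (step P me input gap s inbox).inst = s.inst := by
  rcases h' : s.phase with w | b | _
  · rw [step_idle h'] at h
    split_ifs at h
    all_goals simp [NodeState.start] at h
  · rw [step_inst_of_count h']
    rw [step_active h'] at h
    split_ifs at h ⊢ with h1
    · unfold complete goOn NodeState.start at h
      split_ifs at h
      all_goals simp at h
    · simp only [advance, Phase.active.injEq, Nat.add_right_cancel_iff] at h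
      simp [h]
  · rw [step_halted h'] at h
    simp [receive, h'] at h

theorem step_done (k : ℕ) (h : (step P me input gap s inbox).out.done k = true) :
    ∃ a, s.phase = Phase.active a ∧ s.inst = k ∧
      ((s.receive inbox).evaluateAt P me a).tell P a = true := by
  rcases h' : s.phase with w | b | _
  · rw [step_idle h'] at h
    split_ifs at h <;> simp [NodeState.start, receive, Packet.empty] at h
  · have e : ((s.receive inbox).evaluateAt P me b).inst = s.inst := (evaluateAt_frame b).2.2.2.1
    have : (((s.receive inbox).evaluateAt P me b).advance P b).out.done k = true := by
      rw [step_active h'] at h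
      split_ifs at h
      · rwa [complete_frame.2.2.2] at h
      · exact h
    simp only [advance, e, Bool.and_eq_true, decide_eq_true_eq] at this
    exact ⟨b, rfl, this.2.symm, this.1⟩
  · rw [step_halted h'] at h
    simp [receive, Packet.empty] at h

theorem step_done_of_tell {a : ℕ} (h : s.phase = Phase.active a)
    (ht : ((s.receive inbox).evaluateAt P me a).tell P a = true) :
    (step P me input gap s inbox).out.done s.inst = true := by
  have e : ((s.receive inbox).evaluateAt P me a).inst = s.inst := (evaluateAt_frame a).2.2.2.1
  have : (((s.receive inbox).evaluateAt P me a).advance P a).out.done s.inst = true := by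
    simp [advance, e, ht]
  rw [step_active h]
  split_ifs
  · rwa [complete_frame.2.2.2]
  · exact this

theorem step_output_of_lt {k : ℕ} (hk : k < s.inst) :
    (step P me input gap s inbox).output k = s.output k := by
  rcases h' : s.phase with w | a | _
  · rw [step_idle h']; split_ifs <;> rfl
  · have e : ((s.receive inbox).evaluateAt P me a).inst = s.inst := (evaluateAt_frame a).2.2.2.1
    have e' : ((s.receive inbox).evaluateAt P me a).output = s.output :=
      (evaluateAt_frame a).2.2.1
    rw [step_active h']
    split_ifs
    · rw [complete_frame.1]
      simp [advance, e, e', hk.ne]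
    · simp [advance, e']
  · rw [step_halted h']; rfl

end StepPhase

namespace Scenario

variable {n : ℕ} {V : Type*} [LinearOrder V] [Fintype V] [Nonempty V]
  {P : Params} {σ : Scenario n V}

/-- The packets that node `p` receives in round `τ`. -/
def inbox (P : Params) (σ : Scenario n V) (τ : ℕ) (p : Fin n) : Fin n → Packet n V :=
  fun q => if q ∈ σ.faulty then σ.adv τ q p else (σ.run P τ q).out

theorem run_succ (τ : ℕ) (p : Fin n) : σ.run P (τ + 1) p =
    step P p (σ.input p) (σ.gap p) (σ.run P τ p) (σ.inbox P τ p) := rfl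

theorem inv (τ : ℕ) (p : Fin n) : (σ.run P τ p).Inv P p (σ.input p) := by
  induction τ with
  | zero => exact NodeState.Inv.init
  | succ τ ih => exact ih.step

theorem inst_succ (τ : ℕ) (p : Fin n) : (σ.run P τ p).inst ≤ (σ.run P (τ + 1) p).inst ∧
    (σ.run P (τ + 1) p).inst ≤ (σ.run P τ p).inst + 1 := by
  rw [run_succ]
  by_cases h : ∃ a, (σ.run P τ p).phase = Phase.active a
  · obtain ⟨a, h⟩ := h
    rw [step_inst_of_count h]
    split_ifs <;> omega
  · rw [step_inst_of_not_active (by simpa using h)]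
    omega

theorem inst_mono (p : Fin n) : Monotone fun τ => (σ.run P τ p).inst :=
  monotone_nat_of_le_succ fun τ => (inst_succ τ p).1

theorem phase_succ {a τ : ℕ} {p : Fin n} (h : (σ.run P (τ + 1) p).phase = Phase.active (a + 1)) :
    (σ.run P τ p).phase = Phase.active a ∧ (σ.run P (τ + 1) p).inst = (σ.run P τ p).inst :=
  step_phase_succ h

theorem run_succ_of_inst_eq {a τ : ℕ} {p : Fin n} (h : (σ.run P τ p).phase = Phase.active a)
    (h' : (σ.run P (τ + 1) p).inst = (σ.run P τ p).inst) : σ.run P (τ + 1) p =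
      (((σ.run P τ p).receive (σ.inbox P τ p)).evaluateAt P p a).advance P a :=
  (step_active_stay h h').2

theorem exists_start_of_active {a : ℕ} {p : Fin n} : ∀ {τ : ℕ},
    (σ.run P τ p).phase = Phase.active a →
      ∃ S, σ.StartsAt P (σ.run P τ p).inst p S ∧ τ = S + a := by
  induction a with
  | zero => exact fun {τ} h => ⟨τ, ⟨rfl, h⟩, rfl⟩
  | succ a ih =>
    intro τ h
    cases τ with
    | zero =>
      exact absurd h phase_goOn_ne
    | succ τ =>
      obtain ⟨h1, h2⟩ := phase_succ h
      obtain ⟨S, hS, rfl⟩ := ih h1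
      exact ⟨S, h2 ▸ hS, rfl⟩

theorem StartsAt.phase {k : ℕ} {p : Fin n} {S : ℕ} (hS : σ.StartsAt P k p S) :
    ∀ a : ℕ, (σ.run P (S + a) p).inst = k → (σ.run P (S + a) p).phase = Phase.active a := by
  intro a
  induction a with
  | zero => exact fun _ => hS.2
  | succ a ih =>
    intro h
    have h1 : k ≤ (σ.run P (S + a) p).inst := by
      simpa [hS.1] using inst_mono (P := P) (σ := σ) p (show S ≤ S + a by omega)
    have h2 := (inst_succ (P := P) (σ := σ) (S + a) p).1
    have h3 : (σ.run P (S + a) p).inst = k := by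
      rw [← add_assoc] at h
      omega
    rw [← add_assoc, run_succ_of_inst_eq (ih h3) (by rw [h3]; exact h)]
    rfl

theorem StartsAt.unique {k : ℕ} {p : Fin n} {S S' : ℕ} (hS : σ.StartsAt P k p S)
    (hS' : σ.StartsAt P k p S') : S = S' := by
  wlog h : S ≤ S' generalizing S S'
  · exact (this hS' hS (by omega)).symm
  obtain ⟨a, rfl⟩ := Nat.exists_eq_add_of_le h
  have := hS.phase a hS'.1
  rw [hS'.2] at this
  cases this
  rfl

theorem StartsAt.eq_add {k : ℕ} {p : Fin n} {S a τ : ℕ} (hS : σ.StartsAt P k p S)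
    (hk : (σ.run P τ p).inst = k) (h : (σ.run P τ p).phase = Phase.active a) : τ = S + a := by
  obtain ⟨S', hS', e⟩ := exists_start_of_active h
  rw [hk] at hS'
  rw [e, hS.unique hS']

theorem StartsAt.inst_le {k : ℕ} {p : Fin n} {S τ : ℕ} (hS : σ.StartsAt P k p S) (h : S ≤ τ) :
    k ≤ (σ.run P τ p).inst := by
  simpa [hS.1] using inst_mono (P := P) (σ := σ) p h

theorem StartsAt.inst_eq_of_le {k : ℕ} {p : Fin n} {S τ τ' : ℕ} (hS : σ.StartsAt P k p S)
    (h : S ≤ τ) (h' : τ ≤ τ') (hk : (σ.run P τ' p).inst = k) : (σ.run P τ p).inst = k := by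
  have h1 := hS.inst_le h
  have h2 := inst_mono (P := P) (σ := σ) p h'
  dsimp only at h2
  omega

/-! ### "Done" messages -/

/-- Node `q` has sent "done" for instance `k` by round `τ`. -/
def SentDone (P : Params) (σ : Scenario n V) (k : ℕ) (q : Fin n) (τ : ℕ) : Prop :=
  ∃ τ' ≤ τ, (σ.run P τ' q).out.done k = true

/-- No non-faulty node sends "done" for instance `k` before round `T`. -/
def Quiet (P : Params) (σ : Scenario n V) (k T : ℕ) : Prop :=
  ∀ q, q ∉ σ.faulty → ∀ τ < T, (σ.run P τ q).out.done k = false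

theorem SentDone.mono {k τ τ' : ℕ} {q : Fin n} (h : σ.SentDone P k q τ) (hτ : τ ≤ τ') :
    σ.SentDone P k q τ' := by
  obtain ⟨u, hu, hd⟩ := h
  exact ⟨u, hu.trans hτ, hd⟩

/-- A correct node broadcasts its "done" and the message arrives in the round in which it is sent;
hence the right-hand side does not depend on the receiver `p`. -/
theorem doneLog_succ_iff {k : ℕ} {p q : Fin n} (hq : q ∉ σ.faulty) (τ : ℕ) :
    (σ.run P (τ + 1) p).doneLog q k = true ↔ σ.SentDone P k q τ := by
  induction τ with
  | zero =>
    rw [run_succ, step_doneLog]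
    have : (σ.run P 0 p).doneLog q k = false := by
      change (NodeState.goOn P p _ _ _).doneLog q k = false
      rw [NodeState.goOn_frame.2.1]
    simp [this, inbox, hq, SentDone]
  | succ τ ih =>
    rw [run_succ, step_doneLog]
    simp only [Bool.or_eq_true, ih, inbox, hq, if_false, SentDone]
    constructor
    · rintro (⟨u, hu, hd⟩ | h)
      · exact ⟨u, by omega, hd⟩
      · exact ⟨_, le_rfl, h⟩
    · rintro ⟨u, hu, hd⟩
      rcases hu.lt_or_eq with h | rfl
      · exact .inl ⟨u, by omega, hd⟩
      · exact .inr hd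

/-- The number of nodes from which `p` has received "done" for its current instance by the end of
round `τ`. -/
def dones (P : Params) (σ : Scenario n V) (τ : ℕ) (p : Fin n) : ℕ :=
  ((σ.run P τ p).receive (σ.inbox P τ p)).doneCount

theorem dones_eq (τ : ℕ) (p : Fin n) : σ.dones P τ p =
    (univ.filter fun q => (σ.run P (τ + 1) p).doneLog q (σ.run P τ p).inst = true).card := by
  rw [run_succ, step_doneLog]
  rfl

/-- Correct nodes are counted by both or by neither, so two counts for the same instance differ only
through the faulty nodes. -/
theorem dones_le_add {τ : ℕ} {p p' : Fin n} (h : (σ.run P τ p).inst = (σ.run P τ p').inst) :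
    σ.dones P τ p ≤ σ.dones P τ p' + σ.faulty.card := by
  rw [dones_eq, dones_eq]
  refine le_trans (card_le_card fun q hq => ?_) (card_union_le _ _)
  by_cases hqF : q ∈ σ.faulty
  · exact mem_union_right _ hqF
  · refine mem_union_left _ ?_
    simp only [mem_filter, mem_univ, true_and, doneLog_succ_iff hqF] at hq ⊢
    rwa [← h]

theorem dones_le_of_not_sent {k τ : ℕ} {p : Fin n} (hp : (σ.run P τ p).inst = k)
    (h : ∀ q, q ∉ σ.faulty → ¬ σ.SentDone P k q τ) : σ.dones P τ p ≤ σ.faulty.card := by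
  rw [dones_eq, hp]
  refine card_le_card fun q hq => ?_
  by_contra hqF
  simp only [mem_filter, mem_univ, true_and, doneLog_succ_iff hqF] at hq
  exact h q hqF hq

theorem le_dones_of_all_sent {k t τ : ℕ} {p : Fin n} (hF : σ.faulty.card ≤ t)
    (hp : (σ.run P τ p).inst = k) (h : ∀ q, q ∉ σ.faulty → σ.SentDone P k q τ) :
    n - t ≤ σ.dones P τ p := by
  rw [dones_eq, hp]
  refine (card_honest hF).trans (card_le_card fun q hq => ?_)
  have hqF : q ∉ σ.faulty := by simpa using hq
  simpa [doneLog_succ_iff hqF] using h q hqF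

theorem inst_succ_eq {a τ : ℕ} {p : Fin n} (h : (σ.run P τ p).phase = Phase.active a) :
    (σ.run P (τ + 1) p).inst =
      if 2 * P.t + 1 ≤ σ.dones P τ p then (σ.run P τ p).inst + 1 else (σ.run P τ p).inst :=
  step_inst_of_count h

theorem done_zero (k : ℕ) (p : Fin n) : (σ.run P 0 p).out.done k = false := by
  change (NodeState.goOn P p _ _ _).out.done k = false
  rw [NodeState.goOn_frame.2.2.2.2.2]
  rfl

theorem tell_iff {a τ : ℕ} {p : Fin n} :
    (((σ.run P τ p).receive (σ.inbox P τ p)).evaluateAt P p a).tell P a = true ↔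
      (σ.run P τ p).doneSent = false ∧
      (3 * (((σ.run P τ p).receive (σ.inbox P τ p)).evaluateAt P p a).last * P.len ≤ a + 1 ∨
        P.t + 1 ≤ σ.dones P τ p) := by
  have e : (((σ.run P τ p).receive (σ.inbox P τ p)).evaluateAt P p a).doneSent =
    (σ.run P τ p).doneSent := (NodeState.evaluateAt_frame a).2.2.2.2.2.1
  simp [NodeState.tell, e, NodeState.doneCount_evaluateAt, dones]

theorem done_succ {k τ : ℕ} {p : Fin n} (h : (σ.run P (τ + 1) p).out.done k = true) :
    ∃ a, (σ.run P τ p).phase = Phase.active a ∧ (σ.run P τ p).inst = k ∧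
      (((σ.run P τ p).receive (σ.inbox P τ p)).evaluateAt P p a).tell P a = true :=
  step_done k h

theorem sentDone_of_doneSent {p : Fin n} {a : ℕ} : ∀ {τ : ℕ},
    (σ.run P τ p).phase = Phase.active a → (σ.run P τ p).doneSent = true →
      σ.SentDone P (σ.run P τ p).inst p τ := by
  induction a with
  | zero =>
    intro τ h h'
    rw [((inv τ p).fresh h).doneSent] at h'
    cases h'
  | succ a ih =>
    intro τ h h'
    cases τ with
    | zero => exact absurd h phase_goOn_ne
    | succ τ =>
      obtain ⟨h1, h2⟩ := phase_succ h
      have h3 := run_succ_of_inst_eq h1 h2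
      rw [h2]
      have e : (((σ.run P τ p).receive (σ.inbox P τ p)).evaluateAt P p a).doneSent =
        (σ.run P τ p).doneSent := (NodeState.evaluateAt_frame a).2.2.2.2.2.1
      rw [h3] at h'
      simp only [NodeState.advance, Bool.or_eq_true, e] at h'
      rcases h' with h' | h'
      · exact (ih h1 h').mono (by omega)
      · exact ⟨τ + 1, le_rfl, step_done_of_tell h1 h'⟩

theorem sentDone_of_dones {p : Fin n} {a τ : ℕ} (h : (σ.run P τ p).phase = Phase.active a)
    (hd : P.t + 1 ≤ σ.dones P τ p) : σ.SentDone P (σ.run P τ p).inst p (τ + 1) := by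
  by_cases h' : (σ.run P τ p).doneSent = true
  · exact (sentDone_of_doneSent h h').mono (by omega)
  · exact ⟨τ + 1, le_rfl, step_done_of_tell h (tell_iff.2 ⟨by simpa using h', .inr hd⟩)⟩

/-! ### Completion rounds and outputs -/

theorem active_of_completesAt {k τ : ℕ} {p : Fin n} (h : σ.CompletesAt P k p τ) :
    ∃ a, (σ.run P τ p).phase = Phase.active a := by
  by_contra hc
  have := step_inst_of_not_active (P := P) (me := p) (input := σ.input p) (gap := σ.gap p)
    (inbox := σ.inbox P τ p) (s := σ.run P τ p) (by simpa using hc)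
  rw [← run_succ, h.1, h.2] at this
  omega

theorem dones_of_completesAt {k τ : ℕ} {p : Fin n} (h : σ.CompletesAt P k p τ) :
    2 * P.t + 1 ≤ σ.dones P τ p := by
  obtain ⟨a, ha⟩ := active_of_completesAt h
  have := inst_succ_eq ha
  rw [h.1, h.2] at this
  by_contra hc
  rw [if_neg hc] at this
  omega

/-- Reaching `2t + 1` also passes the threshold `t + 1`. `complete` clears only the protocol part of
the outgoing packet, so a "done" prompted in the completing round is still sent in the next one. -/
theorem sentDone_of_completesAt {k τ : ℕ} {p : Fin n} (h : σ.CompletesAt P k p τ) :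
    σ.SentDone P k p (τ + 1) := by
  obtain ⟨a, ha⟩ := active_of_completesAt h
  have := dones_of_completesAt h
  simpa [h.1] using sentDone_of_dones ha (by omega)

theorem exists_completesAt {k τ τ' : ℕ} {p : Fin n} (hτ : τ ≤ τ') (h : (σ.run P τ p).inst ≤ k)
    (h' : k < (σ.run P τ' p).inst) : ∃ E, τ ≤ E ∧ E < τ' ∧ σ.CompletesAt P k p E := by
  induction τ', hτ using Nat.le_induction with
  | base => omega
  | succ u hu ih =>
    have h1 := inst_succ (P := P) (σ := σ) u p
    by_cases hk : k < (σ.run P u p).inst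
    · obtain ⟨E, h2, h3, h4⟩ := ih hk
      exact ⟨E, h2, by omega, h4⟩
    · exact ⟨u, hu, by omega, by omega, by omega⟩

theorem completesAt_unique {k τ τ' : ℕ} {p : Fin n} (h : σ.CompletesAt P k p τ)
    (h' : σ.CompletesAt P k p τ') : τ = τ' := by
  wlog hle : τ ≤ τ' generalizing τ τ'
  · exact (this h' h (by omega)).symm
  by_contra hne
  have := inst_mono (P := P) (σ := σ) p (show τ + 1 ≤ τ' by omega)
  have h1 := h.2
  have h2 := h'.1
  dsimp only at this
  omega

theorem output_eq_of_lt {k τ τ' : ℕ} {p : Fin n} (hτ : τ ≤ τ') (h : k < (σ.run P τ p).inst) :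
    (σ.run P τ' p).output k = (σ.run P τ p).output k := by
  induction τ', hτ using Nat.le_induction with
  | base => rfl
  | succ u hu ih =>
    rw [run_succ, step_output_of_lt (h.trans_le (inst_mono p hu)), ih]

theorem output_of_outputs {k τ : ℕ} {p : Fin n} {w : V} (h : σ.CompletesAt P k p τ)
    (hw : σ.Outputs P k p w) : (σ.run P (τ + 1) p).output k = some w := by
  obtain ⟨u, hu⟩ := hw
  have hk : k < (σ.run P u p).inst := by
    by_contra hc
    rw [(inv u p).output k (by omega)] at hu
    cases hu
  rcases le_total u (τ + 1) with hle | hle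
  · rw [output_eq_of_lt hle hk, hu]
  · rw [← output_eq_of_lt hle (by rw [h.2]; omega), hu]

/-- Waiting for the start of the next instance. -/
theorem startsAt_of_idle {k : ℕ} {p : Fin n} {w : ℕ} : ∀ {τ : ℕ}, (σ.run P τ p).inst = k →
    (σ.run P τ p).phase = Phase.idle w →
      σ.StartsAt P k p (τ + w) ∧ (σ.run P (τ + w) p).bad = (σ.run P τ p).bad := by
  induction w with
  | zero => exact fun {τ} _ h => absurd rfl ((inv τ p).idle_pos 0 h)
  | succ w ih =>
    intro τ hk h
    have e := step_idle (P := P) (me := p) (input := σ.input p) (gap := σ.gap p)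
      (inbox := σ.inbox P τ p) h
    rw [← run_succ] at e
    split_ifs at e with hw
    · obtain rfl : w = 0 := by omega
      refine ⟨⟨?_, ?_⟩, ?_⟩ <;> rw [zero_add, e]
      · exact hk
      · rfl
      · rfl
    · have := ih (τ := τ + 1) (by rw [e]; exact hk) (by rw [e]; rfl)
      rw [show τ + (w + 1) = τ + 1 + w by omega]
      refine ⟨this.1, this.2.trans ?_⟩
      rw [e]
      rfl

theorem startsAt_zero (h : 0 < P.ell) (p : Fin n) :
    σ.StartsAt P 0 p (σ.gap p 0) ∧ (σ.run P (σ.gap p 0) p).bad = ∅ := by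
  have e : σ.run P 0 p = initState P p (σ.input p) (σ.gap p) := rfl
  by_cases hw : σ.gap p 0 = 0
  · rw [hw]
    refine ⟨⟨?_, ?_⟩, ?_⟩ <;> rw [e] <;>
      simp [initState, NodeState.goOn, h.ne', hw, NodeState.start]
  · have := startsAt_of_idle (P := P) (σ := σ) (k := 0) (p := p) (w := σ.gap p 0) (τ := 0)
      (by rw [e]; simp [initState, NodeState.goOn, h.ne', hw])
      (by rw [e]; simp [initState, NodeState.goOn, h.ne', hw])
    rw [zero_add] at this
    refine ⟨this.1, this.2.trans ?_⟩
    rw [e]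
    simp [initState, NodeState.goOn, h.ne', hw]

theorem startsAt_succ {k τ : ℕ} {p : Fin n} (h : σ.CompletesAt P k p τ) (hk : k + 1 < P.ell) :
    σ.StartsAt P (k + 1) p (τ + 1 + σ.gap p (k + 1)) ∧
      (σ.run P (τ + 1 + σ.gap p (k + 1)) p).bad = (σ.run P (τ + 1) p).bad := by
  obtain ⟨a, ha⟩ := active_of_completesAt h
  have e := (step_active_leave (P := P) (me := p) (input := σ.input p) (gap := σ.gap p)
    (inbox := σ.inbox P τ p) ha (by rw [← run_succ, h.1, h.2]; omega)).2
  rw [← run_succ] at e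
  have hi : (((σ.run P τ p).receive (σ.inbox P τ p)).evaluateAt P p a).inst = k :=
    (NodeState.evaluateAt_frame a).2.2.2.1.trans h.1
  by_cases hw : σ.gap p (k + 1) = 0
  · rw [hw, add_zero]
    refine ⟨⟨h.2, ?_⟩, rfl⟩
    rw [e]
    simp [NodeState.complete, NodeState.goOn, NodeState.advance, hi, hk.not_ge, hw, NodeState.start]
  · refine startsAt_of_idle h.2 ?_
    rw [e]
    simp [NodeState.complete, NodeState.goOn, NodeState.advance, hi, hk.not_ge, hw]

end Scenario

/-! ### The stretched rounds of one instance -/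

/-- The age at which the messages of the first `j` stretched rounds have been evaluated. -/
def Params.checkpoint (P : Params) (j : ℕ) : ℕ := j * P.len - P.Δ

theorem Params.checkpoint_zero (P : Params) : P.checkpoint 0 = 0 := by simp [checkpoint]

theorem Params.checkpoint_succ (P : Params) (j : ℕ) :
    P.checkpoint (j + 1) = j * P.len + P.Δ + 1 := by
  have : (j + 1) * P.len = j * P.len + P.len := by ring
  unfold checkpoint
  rw [this]
  unfold len
  omega

theorem Params.checkpoint_le (P : Params) (j : ℕ) : P.checkpoint j ≤ j * P.len := Nat.sub_le _ _

/-- Evaluations take place only at the ages `i * P.len + P.Δ`, and for positive `j` the checkpoint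
is one past the age that belongs to `i = j - 1`. -/
theorem Params.le_of_mod {P : Params} {a j : ℕ} (h : P.checkpoint j ≤ a) (hm : a % P.len = P.Δ) :
    j ≤ a / P.len := by
  cases j with
  | zero => exact Nat.zero_le _
  | succ j =>
    rw [P.checkpoint_succ] at h
    have h1 := Nat.div_add_mod' a P.len
    by_contra hc
    have h2 : a / P.len * P.len ≤ j * P.len := Nat.mul_le_mul_right _ (by omega)
    omega

theorem Params.mod_div (P : Params) (j : ℕ) :
    (j * P.len + P.Δ) % P.len = P.Δ ∧ (j * P.len + P.Δ) / P.len = j := by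
  have h : P.Δ < P.len := by unfold Params.len; omega
  constructor
  · rw [add_comm, Nat.add_mul_mod_self_right, Nat.mod_eq_of_lt h]
  · rw [add_comm, Nat.add_mul_div_right _ _ (by omega), Nat.div_eq_of_lt h, zero_add]

section

variable {n : ℕ} {V : Type*} [LinearOrder V] [Fintype V] [Nonempty V]

/-- Breaking the loop may lower `last`, but never below the end of the iteration in which this
happens. -/
theorem lt_evaluate_last {P : Params} {me : Fin n} {s : NodeState n V} {i j : ℕ}
    (h : i < s.last) (hi : i ≤ P.t) (hj : 3 * i ≤ j) : i < (s.evaluate P me j).last := by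
  unfold NodeState.evaluate NodeState.endIteration
  dsimp only
  split_ifs with h1 h2 h3 h4
  · exact h
  · exact h
  · exact lt_min (by omega) (by omega)
  · exact h
  · exact h

end

namespace Scenario

variable {n : ℕ} {V : Type*} [LinearOrder V] [Fintype V] [Nonempty V]
  {P : Params} {σ : Scenario n V} {k : ℕ}

/-- A node sends under each tag in a single round. Therefore keeping only the first message per tag
loses nothing from correct senders. -/
theorem StartsAt.eq_of_proto {q : Fin n} {S τ j : ℕ} (hS : σ.StartsAt P k q S)
    (h : (σ.run P τ q).out.proto k j ≠ none) : τ = S + j * P.len := by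
  have hinv := inv (P := P) (σ := σ) τ q
  rcases h' : (σ.run P τ q).phase with w | a | _
  · exact absurd (hinv.proto_idle (by simp [h']) k j) h
  · cases a with
    | zero =>
      rw [(hinv.fresh h').out] at h
      obtain ⟨rfl, rfl⟩ : k = (σ.run P τ q).inst ∧ j = 0 := by
        by_contra hc
        exact h (if_neg hc)
      rw [hS.eq_add rfl h', zero_mul]
    | succ a =>
      rw [hinv.proto a h'] at h
      obtain ⟨rfl, h1, -⟩ : k = (σ.run P τ q).inst ∧ a + 1 = j * P.len ∧
          j < 3 * (σ.run P τ q).last := by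
        by_contra hc
        exact h (if_neg hc)
      rw [hS.eq_add rfl h', h1]
  · exact absurd (hinv.proto_idle (by simp [h']) k j) h

theorem StartsAt.log_eq {p q : Fin n} {S j : ℕ} {m : Ballot n V} (hq : q ∉ σ.faulty)
    (hS : σ.StartsAt P k q S) (h : (σ.run P (S + j * P.len) q).out.proto k j = some m) (τ : ℕ) :
    (σ.run P τ p).log q k j = if S + j * P.len < τ then some m else none := by
  induction τ with
  | zero =>
    change (NodeState.goOn P p _ _ _).log q k j = _
    rw [NodeState.goOn_frame.1]
    simp
  | succ τ ih =>
    rw [run_succ, step_log]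
    simp only [ih, inbox, hq, if_false]
    by_cases h1 : (σ.run P τ q).out.proto k j = none
    · have : S + j * P.len ≠ τ := by
        rintro rfl
        simp [h] at h1
      simp only [h1, Option.or_none]
      congr 1
      simp only [eq_iff_iff]
      omega
    · have := hS.eq_of_proto h1
      subst this
      simp [h]

theorem core_succ {a τ : ℕ} {p : Fin n} (h : (σ.run P τ p).phase = Phase.active a)
    (h' : (σ.run P (τ + 1) p).inst = (σ.run P τ p).inst) : (σ.run P (τ + 1) p).core =
      (((σ.run P τ p).receive (σ.inbox P τ p)).evaluateAt P p a).core := by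
  rw [run_succ_of_inst_eq h h']
  rfl

/-- No evaluation falls between checkpoint `j` and age `j * P.len + P.Δ`: by `Params.le_of_mod` the
next one happens in the round of the latter age and takes effect only afterwards. -/
theorem StartsAt.core_eq {p : Fin n} {S j a b : ℕ} (hS : σ.StartsAt P k p S)
    (ha : P.checkpoint j ≤ a) (hab : a ≤ b) (hb : b ≤ j * P.len + P.Δ)
    (hk : (σ.run P (S + b) p).inst = k) : (σ.run P (S + b) p).core = (σ.run P (S + a) p).core := by
  induction b, hab using Nat.le_induction with
  | base => rfl
  | succ b hab ih =>
    have h1 := hS.inst_eq_of_le (show S ≤ S + b by omega) (show S + b ≤ S + (b + 1) by omega) hk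
    rw [← ih (by omega) h1, ← add_assoc,
      core_succ (hS.phase b h1) (by rw [h1, ← hk, add_assoc]), NodeState.evaluateAt, if_neg]
    · rfl
    · rintro ⟨h2, -⟩
      have h3 := Params.le_of_mod (ha.trans hab) h2
      have h4 := Nat.div_add_mod' b P.len
      have h5 := Nat.mul_le_mul_right P.len h3
      omega

/-- What node `p` has heard at the end of stretched round `j` of instance `k`, which it started in
round `S`, when it ignores the messages of the nodes in `B`. -/
def heardAt (P : Params) (σ : Scenario n V) (k S : ℕ) (p : Fin n) (B : Finset (Fin n)) (j : ℕ)
    (q s : Fin n) : Option V :=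
  if s ∈ B then none else
    ((σ.run P (S + P.checkpoint (j + 1)) p).log s k j).bind fun m => m q

/-- The evaluation at the end of a stretched round. -/
theorem StartsAt.core_checkpoint_succ {p : Fin n} {S j : ℕ} (hS : σ.StartsAt P k p S)
    (hk : (σ.run P (S + P.checkpoint (j + 1)) p).inst = k)
    (hj : j < 3 * (σ.run P (S + P.checkpoint j) p).last) :
    ∃ r : NodeState n V, r.core = (σ.run P (S + P.checkpoint j) p).core ∧
      (∀ q s, r.heard j q s =
        σ.heardAt P k S p (σ.run P (S + P.checkpoint j) p).bad j q s) ∧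
      (σ.run P (S + P.checkpoint (j + 1)) p).core = (r.evaluate P p j).core := by
  have e : S + P.checkpoint (j + 1) = S + (j * P.len + P.Δ) + 1 := by
    rw [P.checkpoint_succ]; omega
  have hle := P.checkpoint_le j
  have h1 := hS.inst_eq_of_le (show S ≤ S + (j * P.len + P.Δ) by omega) (by omega) hk
  have hc := hS.core_eq le_rfl (show P.checkpoint j ≤ j * P.len + P.Δ by omega) le_rfl h1
  have hc' := hc
  simp only [NodeState.core, Prod.mk.injEq] at hc'
  obtain ⟨⟨hbad, -⟩, ⟨-, hlast⟩, -⟩ := hc'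
  refine ⟨(σ.run P (S + (j * P.len + P.Δ)) p).receive (σ.inbox P (S + (j * P.len + P.Δ)) p),
    hc, fun q s => ?_, ?_⟩
  · have hlog : ((σ.run P (S + (j * P.len + P.Δ)) p).receive
        (σ.inbox P (S + (j * P.len + P.Δ)) p)).log =
        (σ.run P (S + P.checkpoint (j + 1)) p).log := by
      rw [e, run_succ, step_log]
      rfl
    unfold NodeState.heard heardAt
    rw [hlog, ← hbad]
    change (if s ∈ _ then none else ((σ.run P _ p).log s (σ.run P _ p).inst j).bind _) = _
    rw [h1]
    rfl
  · rw [e, core_succ (hS.phase _ h1) (by rw [h1, ← hk, e]), NodeState.evaluateAt,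
      (P.mod_div j).2, if_pos]
    refine ⟨(P.mod_div j).1, ?_⟩
    change j < 3 * (σ.run P _ p).last
    rwa [hlast]

/-- The message of a stretched round other than the first one. -/
theorem StartsAt.proto_eq {p : Fin n} {S j : ℕ} (hS : σ.StartsAt P k p S) (hj : j ≠ 0)
    (hk : (σ.run P (S + j * P.len) p).inst = k)
    (hl : j < 3 * (σ.run P (S + P.checkpoint j) p).last) :
    (σ.run P (S + j * P.len) p).out.proto k j =
      some (σ.run P (S + P.checkpoint j) p).next := by
  have hc := hS.core_eq le_rfl (P.checkpoint_le j) (Nat.le_add_right _ _) hk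
  simp only [NodeState.core, Prod.mk.injEq] at hc
  obtain ⟨-, ⟨-, hlast⟩, hnext⟩ := hc
  -- A positive age is needed because `Inv.proto` concerns ages of the form `a + 1`; the message of
  -- stretched round 0 is produced by `start` instead.
  have hpos : 0 < j * P.len := Nat.mul_pos (by omega) (by unfold Params.len; omega)
  obtain ⟨a, ha⟩ : ∃ a, j * P.len = a + 1 := ⟨j * P.len - 1, by omega⟩
  have hp := hS.phase _ hk
  rw [ha] at hp
  rw [ha] at hk hlast hnext ⊢
  rw [(inv (S + (a + 1)) p).proto a hp, if_pos ⟨hk.symm, ha.symm, by rwa [hlast]⟩, hnext]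

theorem StartsAt.proto_zero {p : Fin n} {S : ℕ} (hS : σ.StartsAt P k p S) :
    (σ.run P S p).out.proto k 0 = some (valueMsg p (σ.run P S p).val) := by
  rw [((inv S p).fresh hS.2).out, if_pos ⟨hS.1.symm, rfl⟩]

/-! ### The iterations of one instance -/

/-- The non-faulty nodes start instance `k` in the rounds `S p`, between rounds `M` and
`M + P.Δ`. -/
structure Starts (P : Params) (σ : Scenario n V) (k : ℕ) (S : Fin n → ℕ) (M : ℕ) : Prop where
  startsAt : ∀ p, p ∉ σ.faulty → σ.StartsAt P k p (S p)
  ge : ∀ p, p ∉ σ.faulty → M ≤ S p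
  le : ∀ p, p ∉ σ.faulty → S p ≤ M + P.Δ

/-- The state of node `p` after `i` iterations of the instance that it started in round `S p`. -/
def after (P : Params) (σ : Scenario n V) (S : Fin n → ℕ) (i : ℕ) (p : Fin n) : NodeState n V :=
  σ.run P (S p + P.checkpoint (3 * i)) p

variable {S : Fin n → ℕ} {M : ℕ}

/-- Here the first `Δ + 1` rounds of a stretched round are used: `S q ≤ M + Δ ≤ S p + Δ`, so the
message sent at age `j * P.len` of `q` reaches `p` no later than the round in which `p` evaluates
it. -/
theorem Starts.log_eq (h : σ.Starts P k S M) {p q : Fin n} (hp : p ∉ σ.faulty)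
    (hq : q ∉ σ.faulty) {j : ℕ} {m : Ballot n V}
    (hm : (σ.run P (S q + j * P.len) q).out.proto k j = some m) :
    (σ.run P (S p + P.checkpoint (j + 1)) p).log q k j = some m := by
  rw [(h.startsAt q hq).log_eq hq hm, if_pos]
  have h1 := h.le q hq
  have h2 := h.ge p hp
  rw [P.checkpoint_succ]
  omega

/-- One iteration of the main loop. -/
theorem Starts.iteration (h : σ.Starts P k S M) (hn : 3 * P.t < n) (hF : σ.faulty.card ≤ P.t)
    {i : ℕ} (hk : ∀ p, p ∉ σ.faulty → (σ.after P S (i + 1) p).inst = k)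
    (hlast : ∀ p, p ∉ σ.faulty → i < (σ.after P S i p).last)
    (hbad : ∀ p, p ∉ σ.faulty → (σ.after P S i p).bad ⊆ σ.faulty)
    (hnext : i ≠ 0 → ∀ p, p ∉ σ.faulty →
      (σ.after P S i p).next = valueMsg p (σ.after P S i p).val) :
    ∃ g : Fin n → Fin n → Option V × ℕ,
      GradecastSpec σ.faulty (fun p => (σ.after P S i p).bad) (fun p => (σ.after P S i p).val) g ∧
      ∀ p, p ∉ σ.faulty → (σ.after P S (i + 1) p).core =
        if (σ.after P S i p).inLoop then
          (((σ.after P S i p).bad ∪ suspects (g p), majority (g p)),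
            (decide (confident (g p) < n - P.t),
              if n - P.t ≤ confident (g p) then min (i + 2) (P.t + 1) else (σ.after P S i p).last),
            valueMsg p (majority (g p)))
        else (((σ.after P S i p).bad, (σ.after P S i p).val),
          (false, (σ.after P S i p).last), valueMsg p (σ.after P S i p).val) := by
  have hk3 : ∀ p, p ∉ σ.faulty → (σ.run P (S p + P.checkpoint (3 * i + 2 + 1)) p).inst = k := hk
  have hle : ∀ j, j ≤ 3 * i + 2 → j * P.len ≤ P.checkpoint (3 * i + 2 + 1) := by
    intro j hj
    have := Nat.mul_le_mul_right P.len hj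
    rw [P.checkpoint_succ]
    omega
  have hkj : ∀ j, j ≤ 3 * i + 2 → ∀ p, p ∉ σ.faulty →
      (σ.run P (S p + j * P.len) p).inst = k := fun j hj p hp =>
    (h.startsAt p hp).inst_eq_of_le (by omega) (by have := hle j hj; omega) (hk3 p hp)
  have hkc : ∀ j, j ≤ 3 * i + 2 → ∀ p, p ∉ σ.faulty →
      (σ.run P (S p + P.checkpoint j) p).inst = k := fun j hj p hp =>
    (h.startsAt p hp).inst_eq_of_le (by omega)
      (by have := hle j hj; have := P.checkpoint_le j; omega) (hk3 p hp)
  set B := fun p => (σ.after P S i p).bad with hB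
  set v := fun p => (σ.after P S i p).val with hv
  set h₀ := fun p => σ.heardAt P k (S p) p (B p) (3 * i) with hh₀
  set h₁ := fun p => σ.heardAt P k (S p) p (B p) (3 * i + 1) with hh₁
  set h₂ := fun p => σ.heardAt P k (S p) p (B p) (3 * i + 2) with hh₂
  -- `c₁` and `c₂` follow the state through the first two evaluations, `m₀`, `m₁`, `m₂` are the
  -- messages of the three stretched rounds; together they supply the hypotheses of
  -- `gradecastSpec_of_rounds`.
  have c₁ : ∀ p, p ∉ σ.faulty → (σ.run P (S p + P.checkpoint (3 * i + 1)) p).core =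
      ((B p, v p), ((σ.after P S i p).inLoop, (σ.after P S i p).last), fun q => h₀ p q q) := by
    intro p hp
    obtain ⟨r, hr, hh, hc⟩ := (h.startsAt p hp).core_checkpoint_succ (j := 3 * i)
      (hkc _ (by omega) p hp) (by have := hlast p hp; unfold after at this; omega)
    simp only [NodeState.core, Prod.mk.injEq] at hr
    rw [hc, evaluate_zero]
    simp only [NodeState.core, hr, hh]
    rfl
  have c₂ : ∀ p, p ∉ σ.faulty → (σ.run P (S p + P.checkpoint (3 * i + 2)) p).core =
      ((B p, v p), ((σ.after P S i p).inLoop, (σ.after P S i p).last),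
        fun q => support P.t (h₁ p q)) := by
    intro p hp
    have hc₁ := c₁ p hp
    simp only [NodeState.core, Prod.mk.injEq] at hc₁
    obtain ⟨r, hr, hh, hc⟩ := (h.startsAt p hp).core_checkpoint_succ (j := 3 * i + 1)
      (hkc _ (by omega) p hp) (by rw [hc₁.2.1.2]; have := hlast p hp; omega)
    simp only [NodeState.core, Prod.mk.injEq] at hr
    rw [hc₁.1.1] at hh
    rw [hc, evaluate_one]
    simp only [NodeState.core, hr, hc₁]
    congr 2
    funext q
    exact congrArg _ (funext (hh q))
  have m₀ : ∀ q, q ∉ σ.faulty → (σ.run P (S q + 3 * i * P.len) q).out.proto k (3 * i) =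
      some (valueMsg q (v q)) := by
    intro q hq
    by_cases hi : i = 0
    · subst hi
      have := (h.startsAt q hq).proto_zero
      simpa [hv, after, P.checkpoint_zero] using this
    · rw [(h.startsAt q hq).proto_eq (by omega) (hkj _ (by omega) q hq)
        (by have := hlast q hq; unfold after at this; omega)]
      exact congrArg some (hnext hi q hq)
  have m₁ : ∀ q, q ∉ σ.faulty →
      (σ.run P (S q + (3 * i + 1) * P.len) q).out.proto k (3 * i + 1) =
        some fun l => h₀ q l l := by
    intro q hq
    have hc₁ := c₁ q hq
    simp only [NodeState.core, Prod.mk.injEq] at hc₁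
    rw [(h.startsAt q hq).proto_eq (by omega) (hkj _ (by omega) q hq)
        (by rw [hc₁.2.1.2]; have := hlast q hq; omega), hc₁.2.2]
  have m₂ : ∀ q, q ∉ σ.faulty →
      (σ.run P (S q + (3 * i + 2) * P.len) q).out.proto k (3 * i + 2) =
        some fun l => support P.t (h₁ q l) := by
    intro q hq
    have hc₂ := c₂ q hq
    simp only [NodeState.core, Prod.mk.injEq] at hc₂
    rw [(h.startsAt q hq).proto_eq (by omega) (hkj _ (by omega) q hq)
        (by rw [hc₂.2.1.2]; have := hlast q hq; omega), hc₂.2.2]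
  -- Correct senders are never ignored, so the logged messages are indeed heard.
  have hsB : ∀ p, p ∉ σ.faulty → ∀ s, s ∉ σ.faulty → s ∉ B p :=
    fun p hp s hs hc => hs (hbad p hp hc)
  refine ⟨fun p q => grade P.t (h₂ p q), gradecastSpec_of_rounds hn hF (h₀ := h₀) (h₁ := h₁)
    (fun p hp q hq => ?_) (fun p hp s hs q => ?_) (fun p hp s hs q => ?_) (fun p _ q hq => ?_),
    fun p hp => ?_⟩
  · simp only [hh₀, heardAt, hsB p hp q hq, if_false, h.log_eq hp hq (m₀ q hq)]
    simp [valueMsg]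
  · simp only [hh₁, heardAt, hsB p hp s hs, if_false, h.log_eq hp hs (m₁ s hs)]
    rfl
  · simp only [hh₂, heardAt, hsB p hp s hs, if_false, h.log_eq hp hs (m₂ s hs)]
    rfl
  · simp only [hh₀, heardAt, hq, if_true]
  · have hc₂ := c₂ p hp
    simp only [NodeState.core, Prod.mk.injEq] at hc₂
    obtain ⟨r, hr, hh, hc⟩ := (h.startsAt p hp).core_checkpoint_succ (j := 3 * i + 2)
      (hk p hp) (by rw [hc₂.2.1.2]; have := hlast p hp; omega)
    simp only [NodeState.core, Prod.mk.injEq] at hr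
    rw [hc₂.1.1] at hh
    refine hc.trans ?_
    rw [evaluate_two, endIteration_eq (g := fun q => grade P.t (h₂ p q))
      fun q => congrArg (grade P.t) (funext (hh q)), hr.2.1.1, hc₂.2.1.1]
    by_cases hl : (σ.after P S i p).inLoop = true
    · simp only [NodeState.core, hl, if_true, hr, hc₂]
      rfl
    · simp only [NodeState.core, hl, hr, hc₂]
      rfl

theorem StartsAt.lt_last {p : Fin n} {S i a : ℕ} (hS : σ.StartsAt P k p S)
    (hi : i < (σ.run P (S + P.checkpoint (3 * i)) p).last) (ha : P.checkpoint (3 * i) ≤ a)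
    (hk : (σ.run P (S + a) p).inst = k) : i < (σ.run P (S + a) p).last := by
  induction a, ha using Nat.le_induction with
  | base => exact hi
  | succ a ha ih =>
    have h1 := hS.inst_eq_of_le (show S ≤ S + a by omega) (show S + a ≤ S + (a + 1) by omega) hk
    have h2 := ih h1
    have h3 := (inv (P := P) (σ := σ) (S + a) p).last_le ⟨a, hS.phase a h1⟩
    have hc := core_succ (hS.phase a h1) (by rw [h1, ← hk, add_assoc])
    simp only [NodeState.core, Prod.mk.injEq] at hc
    rw [← add_assoc, hc.2.1.2]
    unfold NodeState.evaluateAt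
    split_ifs with h4
    · exact lt_evaluate_last h2 (by omega) (Params.le_of_mod ha h4.1)
    · exact h2

theorem Quiet.not_sentDone {T τ : ℕ} (h : σ.Quiet P k T) (hτ : τ < T) :
    ∀ q, q ∉ σ.faulty → ¬ σ.SentDone P k q τ := by
  rintro q hq ⟨τ', h1, h2⟩
  rw [h q hq τ' (by omega)] at h2
  cases h2

/-- Without correct senders at most `t` "done" messages can arrive, fewer than the `2t + 1` needed
to leave the instance. -/
theorem StartsAt.inst_of_quiet {p : Fin n} {S T τ : ℕ} (hS : σ.StartsAt P k p S)
    (hF : σ.faulty.card ≤ P.t) (hQ : σ.Quiet P k T) (h : S ≤ τ) (hT : τ ≤ T) :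
    (σ.run P τ p).inst = k := by
  induction τ, h using Nat.le_induction with
  | base => exact hS.1
  | succ τ h ih =>
    have h1 := ih (by omega)
    obtain ⟨a, rfl⟩ := Nat.exists_eq_add_of_le h
    have h2 := dones_le_of_not_sent h1 (hQ.not_sentDone (by omega))
    rw [inst_succ_eq (hS.phase a h1), if_neg (by omega), h1]

/-- The earliest correct "done" cannot be a reaction to `t + 1` others, as one of these would be
correct and earlier. So it comes from a regular return, which takes at least `i + 1` iterations of
three stretched rounds, counted from a start not before `M`. -/
theorem Starts.quiet_succ (h : σ.Starts P k S M) (hF : σ.faulty.card ≤ P.t) {i : ℕ}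
    (hQ : σ.Quiet P k (M + 3 * i * P.len))
    (hlast : ∀ p, p ∉ σ.faulty → i < (σ.after P S i p).last) :
    σ.Quiet P k (M + 3 * (i + 1) * P.len) := by
  intro q hq τ
  induction τ using Nat.strong_induction_on generalizing q with
  | _ τ ih =>
    intro hτ
    by_cases hτ' : τ < M + 3 * i * P.len
    · exact hQ q hq τ hτ'
    cases τ with
    | zero => exact done_zero k q
    | succ u =>
      by_contra hc
      obtain ⟨a, h1, h2, h3⟩ := done_succ (Bool.eq_true_of_not_eq_false hc)
      have hu := (h.startsAt q hq).eq_add h2 h1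
      have h4 := dones_le_of_not_sent h2 (Quiet.not_sentDone (T := u + 1) (P := P) (σ := σ)
        (fun q' hq' τ' hτ' => ih τ' hτ' q' hq' (by omega)) (by omega))
      have h5 := (tell_iff.1 h3).2
      have h6 := inst_succ_eq h1
      rw [if_neg (by omega)] at h6
      have h7 := core_succ h1 h6
      simp only [NodeState.core, Prod.mk.injEq] at h7
      rw [← h7.2.1.2] at h5
      have h8 : 3 * (σ.run P (u + 1) q).last * P.len ≤ a + 1 := by
        rcases h5 with h5 | h5 <;> omega
      have h9 := h.le q hq
      have h9' := h.ge q hq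
      have h10 : i < (σ.run P (u + 1) q).last := by
        rw [hu, add_assoc]
        -- The age at round `u + 1` has passed checkpoint `3 * i`: that round is not before `M + 3 *
        -- i * P.len`, and `q` started by `M + P.Δ`.
        refine (h.startsAt q hq).lt_last (hlast q hq) ?_ (by rw [← add_assoc, ← hu, h6, h2])
        rcases Nat.eq_zero_or_pos i with rfl | hi
        · simp [P.checkpoint_zero]
        · unfold Params.checkpoint
          omega
      have h11 : 3 * (i + 1) * P.len ≤ 3 * (σ.run P (u + 1) q).last * P.len :=
        Nat.mul_le_mul_right _ (by omega)
      omega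

theorem Starts.quiet_zero (h : σ.Starts P k S M) : σ.Quiet P k M := by
  intro q hq τ hτ
  cases τ with
  | zero => exact done_zero k q
  | succ u =>
    by_contra hc
    obtain ⟨a, h1, h2, -⟩ := done_succ (Bool.eq_true_of_not_eq_false hc)
    have hu := (h.startsAt q hq).eq_add h2 h1
    have := h.ge q hq
    omega

end Scenario

/-! ### Progress within an instance, measured by the commonly ignored nodes -/

namespace Scenario

variable {n : ℕ} {V : Type*} [LinearOrder V] [Fintype V] [Nonempty V]
  {P : Params} {σ : Scenario n V} {k : ℕ} {S : Fin n → ℕ} {M i : ℕ}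

/-- The number of nodes that are ignored by every non-faulty node `p` in its state at the
beginning of round `T p`. -/
def commonBad (P : Params) (σ : Scenario n V) (T : Fin n → ℕ) : ℕ :=
  (univ.filter fun q => ∀ p, p ∉ σ.faulty → q ∈ (σ.run P (T p) p).bad).card

theorem commonBad_mono {T T' : Fin n → ℕ}
    (h : ∀ p, p ∉ σ.faulty → (σ.run P (T p) p).bad ⊆ (σ.run P (T' p) p).bad) :
    σ.commonBad P T ≤ σ.commonBad P T' := by
  refine card_le_card fun q hq => ?_
  simp only [mem_filter, mem_univ, true_and] at hq ⊢
  exact fun p hp => h p hp (hq p hp)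

theorem commonBad_lt {T T' : Fin n → ℕ}
    (h : ∀ p, p ∉ σ.faulty → (σ.run P (T p) p).bad ⊆ (σ.run P (T' p) p).bad) {q : Fin n}
    (hq : ¬ ∀ p, p ∉ σ.faulty → q ∈ (σ.run P (T p) p).bad)
    (hq' : ∀ p, p ∉ σ.faulty → q ∈ (σ.run P (T' p) p).bad) :
    σ.commonBad P T < σ.commonBad P T' := by
  refine card_lt_card ⟨fun u hu => ?_, fun hc => ?_⟩
  · simp only [mem_filter, mem_univ, true_and] at hu ⊢
    exact fun p hp => h p hp (hu p hp)
  · have := hc (show q ∈ _ by simpa using hq')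
    exact hq (by simpa using this)

theorem commonBad_le {T : Fin n → ℕ} (hn : 3 * P.t < n) (hF : σ.faulty.card ≤ P.t)
    (h : ∀ p, p ∉ σ.faulty → (σ.run P (T p) p).bad ⊆ σ.faulty) : σ.commonBad P T ≤ P.t := by
  obtain ⟨p, hp⟩ := exists_honest hn hF
  refine le_trans (card_le_card fun q hq => ?_) hF
  simp only [mem_filter, mem_univ, true_and] at hq
  exact h p hp (hq p hp)

/-- After `i` iterations of instance `k`, no non-faulty node has returned yet. -/
structure Checkpoint (P : Params) (σ : Scenario n V) (k : ℕ) (S : Fin n → ℕ) (M i : ℕ) : Prop where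
  quiet : σ.Quiet P k (M + 3 * i * P.len)
  bad : ∀ p, p ∉ σ.faulty → (σ.after P S i p).bad ⊆ σ.faulty
  next : i ≠ 0 → ∀ p, p ∉ σ.faulty → (σ.after P S i p).next = valueMsg p (σ.after P S i p).val

theorem after_zero (p : Fin n) : σ.after P S 0 p = σ.run P (S p) p := by
  simp [after, P.checkpoint_zero]

theorem Starts.checkpoint_zero (h : σ.Starts P k S M)
    (hbad : ∀ p, p ∉ σ.faulty → (σ.run P (S p) p).bad ⊆ σ.faulty) :
    σ.Checkpoint P k S M 0 where
  quiet := by simpa using h.quiet_zero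
  bad p hp := by rw [after_zero]; exact hbad p hp
  next h := absurd rfl h

/-- Quietness keeps all correct nodes in the instance until they have evaluated the next iteration:
the checkpoint lies `Δ` rounds before the end of a stretched round, which compensates for a start as
late as `M + Δ`. -/
theorem Starts.checkpoint_succ (h : σ.Starts P k S M) (hn : 3 * P.t < n)
    (hF : σ.faulty.card ≤ P.t) (hc : σ.Checkpoint P k S M i)
    (hlast : ∀ p, p ∉ σ.faulty → i < (σ.after P S i p).last) :
    σ.Checkpoint P k S M (i + 1) ∧ ∃ g : Fin n → Fin n → Option V × ℕ,
      GradecastSpec σ.faulty (fun p => (σ.after P S i p).bad) (fun p => (σ.after P S i p).val) g ∧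
      ∀ p, p ∉ σ.faulty → (σ.after P S (i + 1) p).core =
        if (σ.after P S i p).inLoop then
          (((σ.after P S i p).bad ∪ suspects (g p), majority (g p)),
            (decide (confident (g p) < n - P.t),
              if n - P.t ≤ confident (g p) then min (i + 2) (P.t + 1) else (σ.after P S i p).last),
            valueMsg p (majority (g p)))
        else (((σ.after P S i p).bad, (σ.after P S i p).val),
          (false, (σ.after P S i p).last), valueMsg p (σ.after P S i p).val) := by
  have hQ := h.quiet_succ hF hc.quiet hlast
  have hk : ∀ p, p ∉ σ.faulty → (σ.after P S (i + 1) p).inst = k := by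
    intro p hp
    refine (h.startsAt p hp).inst_of_quiet hF hQ (by omega) ?_
    have h1 := h.le p hp
    have h2 : P.len ≤ 3 * (i + 1) * P.len := Nat.le_mul_of_pos_left _ (by omega)
    unfold Params.checkpoint
    unfold Params.len at h2 ⊢
    omega
  obtain ⟨g, hg, hcore⟩ := h.iteration hn hF hk hlast hc.bad hc.next
  refine ⟨⟨hQ, fun p hp => ?_, fun _ p hp => ?_⟩, g, hg, hcore⟩
  · have := hcore p hp
    split_ifs at this
    all_goals
      simp only [NodeState.core, Prod.mk.injEq] at this
      rw [this.1.1]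
    · exact union_subset (hc.bad p hp) (hg.suspects_subset hp)
    · exact union_subset (hc.bad p hp) (hg.suspects_subset hp)
    · exact hc.bad p hp
  · have := hcore p hp
    split_ifs at this
    all_goals
      simp only [NodeState.core, Prod.mk.injEq] at this
      rw [this.2.2, this.1.2]

/-- After `i` iterations, no non-faulty node has broken the loop, and each of the iterations has led
to a new node being ignored by all non-faulty nodes. -/
structure Pending (P : Params) (σ : Scenario n V) (k : ℕ) (S : Fin n → ℕ) (M i : ℕ) : Prop
    extends σ.Checkpoint P k S M i where
  inLoop : ∀ p, p ∉ σ.faulty → (σ.after P S i p).inLoop = true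
  last : ∀ p, p ∉ σ.faulty → (σ.after P S i p).last = P.t + 1
  count : σ.commonBad P S + i ≤ σ.commonBad P fun p => S p + P.checkpoint (3 * i)
  valid : ∀ y, (∀ p, p ∉ σ.faulty → (σ.run P (S p) p).val = y) →
    ∀ p, p ∉ σ.faulty → (σ.after P S i p).val = y

/-- After `R` iterations, all non-faulty nodes have the final value `x`. -/
structure Settled (P : Params) (σ : Scenario n V) (k : ℕ) (S : Fin n → ℕ) (M R : ℕ) (x : V) : Prop
    extends σ.Checkpoint P k S M R where
  pos : 0 < R
  val : ∀ p, p ∉ σ.faulty → (σ.after P S R p).val = x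
  frozen : ∀ p, p ∉ σ.faulty → (σ.after P S R p).inLoop = false ∨ (σ.after P S R p).last ≤ R
  last_le : ∀ p, p ∉ σ.faulty → (σ.after P S R p).last ≤ R + 1
  count : σ.commonBad P S + R ≤ (σ.commonBad P fun p => S p + P.checkpoint (3 * R)) + 2
  valid : ∀ y, (∀ p, p ∉ σ.faulty → (σ.run P (S p) p).val = y) → x = y

theorem Starts.pending_zero (h : σ.Starts P k S M)
    (hbad : ∀ p, p ∉ σ.faulty → (σ.run P (S p) p).bad ⊆ σ.faulty) :
    σ.Pending P k S M 0 where
  toCheckpoint := h.checkpoint_zero hbad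
  inLoop p hp := by rw [after_zero]; exact ((inv _ p).fresh (h.startsAt p hp).2).inLoop
  last p hp := by rw [after_zero]; exact ((inv _ p).fresh (h.startsAt p hp).2).last
  count := by simp [P.checkpoint_zero]
  valid y hy p hp := by rw [after_zero]; exact hy p hp

/-- If the non-faulty nodes agree after the first iteration in which some of them may have broken
the loop, then one more iteration suffices. -/
theorem Starts.settled_of_agree (h : σ.Starts P k S M) (hn : 3 * P.t < n)
    (hF : σ.faulty.card ≤ P.t) {x : V} (hi : i ≤ P.t) (hc : σ.Checkpoint P k S M (i + 1))
    (hval : ∀ p, p ∉ σ.faulty → (σ.after P S (i + 1) p).val = x)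
    (hlast : ∀ p, p ∉ σ.faulty → min (i + 2) (P.t + 1) ≤ (σ.after P S (i + 1) p).last ∧
      (σ.after P S (i + 1) p).last ≤ P.t + 1)
    (hloop : ∀ p, p ∉ σ.faulty → (σ.after P S (i + 1) p).inLoop = false →
      (σ.after P S (i + 1) p).last ≤ i + 2)
    (hcount : σ.commonBad P S + i ≤ σ.commonBad P fun p => S p + P.checkpoint (3 * (i + 1)))
    (hvalid : ∀ y, (∀ p, p ∉ σ.faulty → (σ.run P (S p) p).val = y) → x = y) :
    ∃ R, σ.Settled P k S M R x := by
  -- After iteration `t + 1` no evaluation is left, so all values are final at once. Otherwise one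
  -- unanimous iteration follows; nodes that have already broken the loop still take part in it,
  -- because their `last` is `i + 2`.
  rcases hi.eq_or_lt with rfl | hi
  · exact ⟨P.t + 1, hc, by omega, hval, fun p hp => .inr (hlast p hp).2,
      fun p hp => (hlast p hp).2.trans (by omega), by omega, hvalid⟩
  · obtain ⟨hc', g, hg, hcore⟩ := h.checkpoint_succ hn hF hc
      fun p hp => by have := (hlast p hp).1; omega
    have key : ∀ p, p ∉ σ.faulty → (σ.after P S (i + 1 + 1) p).val = x ∧
        (σ.after P S (i + 1 + 1) p).inLoop = false ∧
        (σ.after P S (i + 1 + 1) p).last ≤ i + 1 + 1 + 1 ∧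
        (σ.after P S (i + 1) p).bad ⊆ (σ.after P S (i + 1 + 1) p).bad := by
      intro p hp
      have hm := hg.majority_eq_of_forall hn hF hval hp
      have hcf := hg.confident_of_forall hn hF hval hp
      have := hcore p hp
      rw [hm, if_pos hcf, decide_eq_false (by omega)] at this
      split_ifs at this with hl
      all_goals simp only [NodeState.core, Prod.mk.injEq] at this
      · refine ⟨this.1.2, this.2.1.1, ?_, ?_⟩
        · rw [this.2.1.2]; omega
        · rw [this.1.1]; exact subset_union_left
      · refine ⟨this.1.2.trans (hval p hp), this.2.1.1, ?_, ?_⟩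
        · rw [this.2.1.2]
          have := hloop p hp (by simpa using hl)
          omega
        · rw [this.1.1]
    refine ⟨i + 1 + 1, hc', by omega, fun p hp => (key p hp).1, fun p hp => .inl (key p hp).2.1,
      fun p hp => (key p hp).2.2.1, ?_, hvalid⟩
    have := commonBad_mono (P := P) (σ := σ) fun p hp => (key p hp).2.2.2
    omega

/-- If the correct values agree after the iteration, the instance settles. If not, nobody can have
broken the loop, since a confident majority would be shared by all, and `exists_suspect` yields a
newly common ignored node. -/
theorem Starts.pending_succ (h : σ.Starts P k S M) (hn : 3 * P.t < n)
    (hF : σ.faulty.card ≤ P.t) (hp : σ.Pending P k S M i) (hi : i ≤ P.t) :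
    σ.Pending P k S M (i + 1) ∨ ∃ R x, σ.Settled P k S M R x := by
  obtain ⟨p₀, hp₀⟩ := exists_honest hn hF
  obtain ⟨hc, g, hg, hcore⟩ := h.checkpoint_succ hn hF hp.toCheckpoint
    fun p hp' => by rw [hp.last p hp']; omega
  have hcore' : ∀ p, p ∉ σ.faulty →
      (σ.after P S (i + 1) p).bad = (σ.after P S i p).bad ∪ suspects (g p) ∧
      (σ.after P S (i + 1) p).val = majority (g p) ∧
      (σ.after P S (i + 1) p).inLoop = decide (confident (g p) < n - P.t) ∧
      (σ.after P S (i + 1) p).last =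
        if n - P.t ≤ confident (g p) then min (i + 2) (P.t + 1) else P.t + 1 := by
    intro p hp'
    have := hcore p hp'
    rw [if_pos (hp.inLoop p hp'), hp.last p hp'] at this
    simp only [NodeState.core, Prod.mk.injEq] at this
    exact ⟨this.1.1, this.1.2, this.2.1.1, this.2.1.2⟩
  have hsub : ∀ p, p ∉ σ.faulty → (σ.after P S i p).bad ⊆ (σ.after P S (i + 1) p).bad :=
    fun p hp' => by rw [(hcore' p hp').1]; exact subset_union_left
  have hvalid : ∀ y, (∀ p, p ∉ σ.faulty → (σ.run P (S p) p).val = y) →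
      ∀ p, p ∉ σ.faulty → (σ.after P S (i + 1) p).val = y := fun y hy p hp' => by
    rw [(hcore' p hp').2.1, hg.majority_eq_of_forall hn hF (hp.valid y hy) hp']
  by_cases hx : ∃ x, ∀ p, p ∉ σ.faulty → (σ.after P S (i + 1) p).val = x
  · obtain ⟨x, hx⟩ := hx
    obtain ⟨R, hR⟩ := h.settled_of_agree hn hF hi hc hx
      (fun p hp' => by rw [(hcore' p hp').2.2.2]; split_ifs <;> omega)
      (fun p hp' hl => by
        rw [(hcore' p hp').2.2.1, decide_eq_false_iff_not] at hl
        rw [(hcore' p hp').2.2.2, if_pos (by omega)]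
        omega)
      (hp.count.trans (commonBad_mono hsub))
      fun y hy => (hx p₀ hp₀).symm.trans (hvalid y hy p₀ hp₀)
    exact .inr ⟨R, x, hR⟩
  · left
    have hnc : ∀ p, p ∉ σ.faulty → confident (g p) < n - P.t := by
      intro p hp'
      by_contra hcf
      exact hx ⟨majority (g p), fun q hq => by
        rw [(hcore' q hq).2.1, hg.majority_eq_of_confident hn hp' hq (by omega)]⟩
    obtain ⟨p₁, hp₁, hne⟩ : ∃ p, p ∉ σ.faulty ∧ majority (g p₀) ≠ majority (g p) := by
      by_contra! hcon
      exact hx ⟨majority (g p₀), fun q hq => by rw [(hcore' q hq).2.1, hcon q hq]⟩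
    obtain ⟨q, hq, hq'⟩ := hg.exists_suspect hp₀ hp₁ hne
    refine ⟨hc, fun p hp' => ?_, fun p hp' => ?_, ?_, hvalid⟩
    · rw [(hcore' p hp').2.2.1, decide_eq_true (hnc p hp')]
    · rw [(hcore' p hp').2.2.2, if_neg (by have := hnc p hp'; omega)]
    · have h1 := hp.count
      have h2 := commonBad_lt hsub hq fun p hp' => by
        have := mem_union_right (σ.after P S i p).bad (hq' p hp')
        rwa [← (hcore' p hp').1] at this
      omega

/-- `t + 1` pending iterations would make `t + 1` nodes commonly ignored, but all of these are
faulty. -/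
theorem Starts.exists_settled (h : σ.Starts P k S M) (hn : 3 * P.t < n)
    (hF : σ.faulty.card ≤ P.t)
    (hbad : ∀ p, p ∉ σ.faulty → (σ.run P (S p) p).bad ⊆ σ.faulty) :
    ∃ R x, σ.Settled P k S M R x := by
  by_contra hcon
  have key : ∀ i, i ≤ P.t + 1 → σ.Pending P k S M i := by
    intro i
    induction i with
    | zero => exact fun _ => h.pending_zero hbad
    | succ i ih =>
      exact fun hi => (h.pending_succ hn hF (ih (by omega)) (by omega)).resolve_right hcon
  have h1 := key (P.t + 1) le_rfl
  have h2 := commonBad_le hn hF h1.bad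
  have h3 := h1.count
  omega

/-! ### Completing an instance -/

/-- Two reasons for stability: a node outside the loop merely relays, and a node with `last ≤ R`
performs no evaluation from stretched round `3 * R` on. -/
theorem evaluateAt_of_frozen {s : NodeState n V} {me : Fin n} {R a : ℕ}
    (h : s.inLoop = false ∨ s.last ≤ R) (ha : P.checkpoint (3 * R) ≤ a) :
    (s.evaluateAt P me a).val = s.val ∧ (s.evaluateAt P me a).bad = s.bad ∧
    (s.evaluateAt P me a).inLoop = s.inLoop ∧ (s.evaluateAt P me a).last = s.last := by
  unfold NodeState.evaluateAt
  split_ifs with h1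
  · rcases h with h | h
    · exact evaluate_core_of_frozen h
    · have := Params.le_of_mod ha h1.1
      omega
  · simp

theorem completesAt_frame {a τ : ℕ} {p : Fin n} (h : σ.CompletesAt P k p τ)
    (ha : (σ.run P τ p).phase = Phase.active a) :
    (σ.run P (τ + 1) p).output k =
      some (((σ.run P τ p).receive (σ.inbox P τ p)).evaluateAt P p a).val ∧
    (σ.run P (τ + 1) p).bad =
      (((σ.run P τ p).receive (σ.inbox P τ p)).evaluateAt P p a).bad := by
  have e := (step_active_leave (P := P) (me := p) (input := σ.input p) (gap := σ.gap p)
    (inbox := σ.inbox P τ p) ha (by rw [← run_succ, h.1, h.2]; omega)).2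
  have hi : ((((σ.run P τ p).receive (σ.inbox P τ p)).evaluateAt P p a).advance P a).inst = k :=
    (NodeState.evaluateAt_frame a).2.2.2.1.trans h.1
  rw [run_succ, e, complete_frame.1, complete_frame.2.2.1, hi]
  simp [NodeState.advance]

variable {R : ℕ} {x : V}

theorem Settled.eq_of_le (hs : σ.Settled P k S M R x) (h : σ.Starts P k S M) {p : Fin n}
    (hp : p ∉ σ.faulty) {a : ℕ} (ha : P.checkpoint (3 * R) ≤ a)
    (hk : (σ.run P (S p + a) p).inst = k) :
    (σ.run P (S p + a) p).val = x ∧ (σ.run P (S p + a) p).bad = (σ.after P S R p).bad ∧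
    (σ.run P (S p + a) p).inLoop = (σ.after P S R p).inLoop ∧
    (σ.run P (S p + a) p).last = (σ.after P S R p).last := by
  induction a, ha using Nat.le_induction with
  | base => exact ⟨hs.val p hp, rfl, rfl, rfl⟩
  | succ a ha ih =>
    have h1 := (h.startsAt p hp).inst_eq_of_le (show S p ≤ S p + a by omega)
      (show S p + a ≤ S p + (a + 1) by omega) hk
    obtain ⟨i1, i2, i3, i4⟩ := ih h1
    have hc := core_succ ((h.startsAt p hp).phase a h1) (by rw [h1, ← hk, add_assoc])
    simp only [NodeState.core, Prod.mk.injEq] at hc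
    obtain ⟨f1, f2, f3, f4⟩ := evaluateAt_of_frozen (me := p)
      (s := (σ.run P (S p + a) p).receive (σ.inbox P (S p + a) p))
      (by have := hs.frozen p hp; rw [← i3, ← i4] at this; exact this) ha
    rw [← add_assoc, hc.1.1, hc.1.2, hc.2.1.1, hc.2.1.2, f1, f2, f3, f4]
    exact ⟨i1, i2, i3, i4⟩

theorem Settled.le_of_completesAt (hs : σ.Settled P k S M R x) (hF : σ.faulty.card ≤ P.t)
    {p : Fin n} {E : ℕ} (hE : σ.CompletesAt P k p E) : M + 3 * R * P.len ≤ E := by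
  by_contra hlt
  have h1 := dones_of_completesAt hE
  have h2 := dones_le_of_not_sent hE.1 (hs.quiet.not_sentDone (by omega))
  omega

theorem Settled.start_le (hs : σ.Settled P k S M R x) (h : σ.Starts P k S M) {p : Fin n}
    (hp : p ∉ σ.faulty) : S p + P.checkpoint (3 * R) ≤ M + 3 * R * P.len := by
  have h1 := h.le p hp
  have h2 : P.len ≤ 3 * R * P.len :=
    Nat.le_mul_of_pos_left _ (Nat.mul_pos (by omega) hs.pos)
  unfold Params.checkpoint
  unfold Params.len at h2 ⊢
  omega

theorem Settled.output (hs : σ.Settled P k S M R x) (h : σ.Starts P k S M)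
    (hF : σ.faulty.card ≤ P.t) {p : Fin n} (hp : p ∉ σ.faulty) {E : ℕ}
    (hE : σ.CompletesAt P k p E) :
    (σ.run P (E + 1) p).output k = some x ∧
      (σ.run P (E + 1) p).bad = (σ.after P S R p).bad := by
  have h1 := hs.le_of_completesAt hF hE
  have h2 := hs.start_le h hp
  obtain ⟨a, rfl⟩ := Nat.exists_eq_add_of_le (show S p ≤ E by omega)
  obtain ⟨i1, i2, i3, i4⟩ := hs.eq_of_le h hp (show P.checkpoint (3 * R) ≤ a by omega) hE.1
  obtain ⟨f1, f2, -⟩ := evaluateAt_of_frozen (me := p) (R := R) (a := a) (P := P)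
      (s := (σ.run P (S p + a) p).receive (σ.inbox P (S p + a) p))
      (by have := hs.frozen p hp; rw [← i3, ← i4] at this; exact this) (by omega)
  obtain ⟨e1, e2⟩ := completesAt_frame hE ((h.startsAt p hp).phase a hE.1)
  rw [e1, e2, f1, f2]
  exact ⟨congrArg some i1, i2⟩

theorem Starts.sentDone_of_lt_inst (h : σ.Starts P k S M) {q : Fin n} (hq : q ∉ σ.faulty) {τ : ℕ}
    (hτ : S q ≤ τ) (hk : (σ.run P τ q).inst ≠ k) : σ.SentDone P k q τ := by
  have := (h.startsAt q hq).inst_le hτ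
  obtain ⟨E, -, h1, h2⟩ := exists_completesAt hτ (h.startsAt q hq).1.le (by omega)
  exact (sentDone_of_completesAt h2).mono h1

/-- The deadline is the latest possible start plus `R + 1` iterations, the extra one for nodes that
broke the loop in iteration `R`. Nodes that have left the instance earlier sent "done" when
completing it. -/
theorem Settled.sentDone (hs : σ.Settled P k S M R x) (h : σ.Starts P k S M) {q : Fin n}
    (hq : q ∉ σ.faulty) : σ.SentDone P k q (M + P.Δ + 3 * (R + 1) * P.len) := by
  have h1 := h.le q hq
  by_cases hk : (σ.run P (M + P.Δ + 3 * (R + 1) * P.len) q).inst = k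
  · obtain ⟨b, hb⟩ := Nat.exists_eq_add_of_le
      (show S q ≤ M + P.Δ + 3 * (R + 1) * P.len by omega)
    have h2 : 3 * (R + 1) * P.len = 3 * R * P.len + 3 * P.len := by ring
    have h3 : 1 ≤ P.len := by unfold Params.len; omega
    obtain ⟨a, rfl⟩ : ∃ a, b = a + 1 := ⟨b - 1, by omega⟩
    rw [hb] at hk ⊢
    have hph := (h.startsAt q hq).phase _ hk
    have hl := (hs.eq_of_le h hq (a := a + 1)
      (by have := P.checkpoint_le (3 * R); omega) hk).2.2.2
    have h4 : 3 * (σ.run P (S q + (a + 1)) q).last * P.len ≤ 3 * (R + 1) * P.len := by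
      rw [hl]
      exact Nat.mul_le_mul_right _ (Nat.mul_le_mul_left _ (hs.last_le q hq))
    have := sentDone_of_doneSent hph ((inv _ q).done a hph (by omega))
    rwa [hk] at this
  · exact h.sentDone_of_lt_inst hq (by omega) hk

theorem Starts.inst_succ_of_all_sent (h : σ.Starts P k S M) (hn : 3 * P.t < n)
    (hF : σ.faulty.card ≤ P.t) {p : Fin n} (hp : p ∉ σ.faulty) {τ : ℕ} (hτ : S p ≤ τ)
    (hall : ∀ q, q ∉ σ.faulty → σ.SentDone P k q τ) : k < (σ.run P (τ + 1) p).inst := by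
  by_cases hk : (σ.run P τ p).inst = k
  · obtain ⟨a, rfl⟩ := Nat.exists_eq_add_of_le hτ
    have := le_dones_of_all_sent hF hk hall
    rw [inst_succ_eq ((h.startsAt p hp).phase a hk), if_pos (by omega)]
    omega
  · have h1 := (h.startsAt p hp).inst_le hτ
    have h2 := (inst_succ (P := P) (σ := σ) τ p).1
    omega

theorem Settled.exists_completesAt (hs : σ.Settled P k S M R x) (h : σ.Starts P k S M)
    (hn : 3 * P.t < n) (hF : σ.faulty.card ≤ P.t) {p : Fin n} (hp : p ∉ σ.faulty) :
    ∃ E, σ.CompletesAt P k p E ∧ E ≤ M + P.Δ + 3 * (R + 1) * P.len := by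
  have h1 := h.le p hp
  have h2 := h.inst_succ_of_all_sent hn hF hp
    (show S p ≤ M + P.Δ + 3 * (R + 1) * P.len by omega) fun q hq => hs.sentDone h hq
  obtain ⟨E, -, h3, h4⟩ := Scenario.exists_completesAt (show S p ≤ _ by omega)
    (h.startsAt p hp).1.le h2
  exact ⟨E, h4, by omega⟩

/-- When one node completes, every correct node either has left the instance or sees enough "done"
messages to send its own in the next round. The at least `n - t ≥ 2t + 1` correct messages then
finish the instance everywhere. -/
theorem Settled.completion_skew (hs : σ.Settled P k S M R x) (h : σ.Starts P k S M)
    (hn : 3 * P.t < n) (hF : σ.faulty.card ≤ P.t) {p q : Fin n}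
    (hq : q ∉ σ.faulty) {τ τ' : ℕ} (hτ : σ.CompletesAt P k p τ) (hτ' : σ.CompletesAt P k q τ') :
    τ' ≤ τ + 1 := by
  have h1 := hs.le_of_completesAt hF hτ
  have hS : ∀ u, u ∉ σ.faulty → S u ≤ τ := fun u hu => by
    have := hs.start_le h hu
    omega
  have hall : ∀ u, u ∉ σ.faulty → σ.SentDone P k u (τ + 1) := by
    intro u hu
    by_cases hk : (σ.run P τ u).inst = k
    · obtain ⟨a, rfl⟩ := Nat.exists_eq_add_of_le (hS u hu)
      -- At most `t` of the `2t + 1` messages at `p` are from faulty nodes, so `u` has received at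
      -- least `t + 1`.
      have h2 := dones_le_add (P := P) (σ := σ) (p := p) (p' := u) (hτ.1.trans hk.symm)
      have h3 := dones_of_completesAt hτ
      have := sentDone_of_dones ((h.startsAt u hu).phase a hk) (by omega)
      rwa [hk] at this
    · exact (h.sentDone_of_lt_inst hu (hS u hu) hk).mono (by omega)
  have h2 := h.inst_succ_of_all_sent hn hF hq (τ := τ + 1) (by have := hS q hq; omega) hall
  by_contra hc
  have h3 := inst_mono (P := P) (σ := σ) q (show τ + 1 + 1 ≤ τ' by omega)
  have h4 := hτ'.1
  dsimp only at h3
  omega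

/-- The properties of the completion of instance `k` in an execution in which the non-faulty nodes
start it in the rounds `S p`. The nodes complete it in the rounds `E p`, with output `x`. -/
structure Completed (P : Params) (σ : Scenario n V) (k : ℕ) (S E : Fin n → ℕ) (x : V) : Prop where
  completesAt : ∀ p, p ∉ σ.faulty → σ.CompletesAt P k p (E p)
  output : ∀ p, p ∉ σ.faulty → (σ.run P (E p + 1) p).output k = some x
  valid : ∀ y, (∀ p, p ∉ σ.faulty → σ.input p k = y) → x = y
  skew : ∀ p, p ∉ σ.faulty → ∀ q, q ∉ σ.faulty → E q ≤ E p + 1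
  bad : ∀ p, p ∉ σ.faulty → (σ.run P (E p + 1) p).bad ⊆ σ.faulty
  time : ∀ p, p ∉ σ.faulty → E p + 1 + 3 * P.len * σ.commonBad P S ≤
    S p + (P.Δ + 1 + 9 * P.len) + 3 * P.len * σ.commonBad P fun p => E p + 1

theorem Starts.exists_completed (h : σ.Starts P k S M) (hn : 3 * P.t < n)
    (hF : σ.faulty.card ≤ P.t)
    (hbad : ∀ p, p ∉ σ.faulty → (σ.run P (S p) p).bad ⊆ σ.faulty) :
    ∃ E x, σ.Completed P k S E x := by
  obtain ⟨R, x, hs⟩ := h.exists_settled hn hF hbad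
  have hex : ∀ p, ∃ E, p ∉ σ.faulty →
      σ.CompletesAt P k p E ∧ E ≤ M + P.Δ + 3 * (R + 1) * P.len := fun p => by
    by_cases hp : p ∈ σ.faulty
    · exact ⟨0, fun h => absurd hp h⟩
    · obtain ⟨E, hE⟩ := hs.exists_completesAt h hn hF hp
      exact ⟨E, fun _ => hE⟩
  choose E hE using hex
  have hout := fun p hp => hs.output h hF hp (hE p hp).1
  refine ⟨E, x, fun p hp => (hE p hp).1, fun p hp => (hout p hp).1, fun y hy => ?_,
    fun p hp q hq => hs.completion_skew h hn hF hq (hE p hp).1 (hE q hq).1, fun p hp => ?_,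
    fun p hp => ?_⟩
  · refine hs.valid y fun p hp => ?_
    have hst := h.startsAt p hp
    rw [((inv _ p).fresh hst.2).val, hst.1, hy p hp]
  · rw [(hout p hp).2]
    exact hs.bad p hp
  · have h1 := (hE p hp).2
    have h2 := h.ge p hp
    have h3 : (σ.commonBad P fun p => S p + P.checkpoint (3 * R)) ≤
        σ.commonBad P fun p => E p + 1 :=
      commonBad_mono fun p hp => ((hout p hp).2).ge
    -- The `R + 1` iterations are paid for by the growth of the potential, except for three: two
    -- from `Settled.count`, one for the final participation. At `3 * P.len` rounds each, these give
    -- the constant `9 * P.len`.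
    have h4 := Nat.mul_le_mul_left (3 * P.len) (show σ.commonBad P S + (R + 1) ≤
        (σ.commonBad P fun p => E p + 1) + 3 by have := hs.count; omega)
    have h5 : 3 * P.len * (σ.commonBad P S + (R + 1)) =
      3 * P.len * σ.commonBad P S + 3 * (R + 1) * P.len := by ring
    have h6 : 3 * P.len * ((σ.commonBad P fun p => E p + 1) + 3) =
      (3 * P.len * σ.commonBad P fun p => E p + 1) + 9 * P.len := by ring
    omega

/-! ### The sequence of instances -/

/-- `M` is the earliest correct start; the skew assumption bounds all others. -/
theorem exists_starts (hn : 3 * P.t < n) (hF : σ.faulty.card ≤ P.t) (hσ : σ.StartSkewLE P)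
    (hk : k < P.ell) (h : ∀ p, p ∉ σ.faulty → σ.StartsAt P k p (S p)) :
    ∃ M, σ.Starts P k S M := by
  obtain ⟨p₀, hp₀⟩ := exists_honest hn hF
  obtain ⟨p, hp, hmin⟩ := exists_min_image (univ.filter fun p => p ∉ σ.faulty) S
    ⟨p₀, by simpa using hp₀⟩
  simp only [mem_filter, mem_univ, true_and] at hp hmin
  exact ⟨S p, h, hmin, fun q hq => hσ k hk p hp q hq _ _ (h p hp) (h q hq)⟩

/-- Amortisation: every instance costs a fixed amount plus `3 * P.len` per newly common ignored
node. The potential never decreases between instances, so the variable costs telescope. -/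
theorem exists_starts_completed (hn : 3 * P.t < n) (hF : σ.faulty.card ≤ P.t)
    (hσ : σ.StartSkewLE P) (hk : k < P.ell) : ∃ S M E x, σ.Starts P k S M ∧
      σ.Completed P k S E x ∧ ∀ p, p ∉ σ.faulty → E p + 1 ≤ ∑ j ∈ range (k + 1), σ.gap p j +
        (k + 1) * (P.Δ + 1 + 9 * P.len) + 3 * P.len * σ.commonBad P fun p => E p + 1 := by
  induction k with
  | zero =>
    obtain ⟨M, hM⟩ := exists_starts (S := fun p => σ.gap p 0) hn hF hσ hk
      fun p _ => (startsAt_zero hk p).1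
    obtain ⟨E, x, hE⟩ := hM.exists_completed hn hF fun p _ => by
      rw [(startsAt_zero hk p).2]; exact empty_subset _
    refine ⟨_, M, E, x, hM, hE, fun p hp => ?_⟩
    have := hE.time p hp
    rw [zero_add, one_mul, sum_range_one]
    omega
  | succ k ih =>
    obtain ⟨S, M, E, x, -, hE, htime⟩ := ih (by omega)
    have hst := fun p hp => startsAt_succ (hE.completesAt p hp) hk
    obtain ⟨M', hM'⟩ := exists_starts (S := fun p => E p + 1 + σ.gap p (k + 1)) hn hF hσ hk
      fun p hp => (hst p hp).1
    obtain ⟨E', x', hE'⟩ := hM'.exists_completed hn hF fun p hp => by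
      rw [(hst p hp).2]; exact hE.bad p hp
    refine ⟨_, M', E', x', hM', hE', fun p hp => ?_⟩
    have h1 := hE'.time p hp
    have h2 := htime p hp
    -- BAD is unchanged while waiting, so the potential at the next start is at least that at the
    -- last completion.
    have h3 : (σ.commonBad P fun p => E p + 1) ≤
        σ.commonBad P fun p => E p + 1 + σ.gap p (k + 1) :=
      commonBad_mono fun p hp => ((hst p hp).2).ge
    have h4 := Nat.mul_le_mul_left (3 * P.len) h3
    rw [sum_range_succ, add_mul (k + 1) 1, one_mul]
    omega

theorem isSome_output {τ : ℕ} {p : Fin n} (hk : k < (σ.run P τ p).inst) :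
    ((σ.run P τ p).output k).isSome := by
  have h0 : (σ.run P 0 p).inst ≤ k := by
    change (NodeState.goOn P p _ _ _).inst ≤ k
    rw [NodeState.goOn_frame.2.2.2.1]
    exact Nat.zero_le _
  obtain ⟨E, -, hE, hc⟩ := exists_completesAt (Nat.zero_le τ) h0 hk
  obtain ⟨a, ha⟩ := active_of_completesAt hc
  rw [output_eq_of_lt hE (by rw [hc.2]; omega), (completesAt_frame hc ha).1]
  rfl

theorem terminatesWithin (hn : 3 * P.t < n) (hF : σ.faulty.card ≤ P.t) (hσ : σ.StartSkewLE P) :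
    σ.TerminatesWithin P (P.ell * (P.Δ + 1 + 9 * P.len) + 3 * P.len * P.t) := by
  intro p hp τ hτ
  have key : P.ell ≤ (σ.run P τ p).inst := by
    rcases Nat.eq_zero_or_pos P.ell with h0 | h0
    · omega
    · obtain ⟨m, hm⟩ : ∃ m, P.ell = m + 1 := ⟨P.ell - 1, by omega⟩
      obtain ⟨S, M, E, x, -, hE, htime⟩ := exists_starts_completed (k := m) hn hF hσ (by omega)
      have h1 := htime p hp
      have h2 := Nat.mul_le_mul_left (3 * P.len) (commonBad_le hn hF hE.bad)
      rw [hm] at hτ ⊢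
      have h3 := inst_mono (P := P) (σ := σ) p (show E p + 1 ≤ τ by omega)
      have h4 := (hE.completesAt p hp).2
      dsimp only at h3
      omega
  exact ⟨(inv τ p).halted_iff.2 key, fun k hk => isSome_output (hk.trans_le key)⟩

theorem agreement (hn : 3 * P.t < n) (hF : σ.faulty.card ≤ P.t) (hσ : σ.StartSkewLE P) :
    σ.Agreement P := by
  intro k hk p hp q hq v w hv hw
  obtain ⟨S, M, E, x, -, hE, -⟩ := exists_starts_completed hn hF hσ hk
  have h1 := output_of_outputs (hE.completesAt p hp) hv
  have h2 := output_of_outputs (hE.completesAt q hq) hw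
  rw [hE.output p hp] at h1
  rw [hE.output q hq] at h2
  exact Option.some.inj (h1.symm.trans h2)

theorem validity (hn : 3 * P.t < n) (hF : σ.faulty.card ≤ P.t) (hσ : σ.StartSkewLE P) :
    σ.Validity P := by
  intro k hk v hv p hp w hw
  obtain ⟨S, M, E, x, -, hE, -⟩ := exists_starts_completed hn hF hσ hk
  have h1 := output_of_outputs (hE.completesAt p hp) hw
  rw [hE.output p hp] at h1
  rw [← hE.valid v hv, Option.some.inj h1]

theorem completionSkewLEOne (hn : 3 * P.t < n) (hF : σ.faulty.card ≤ P.t)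
    (hσ : σ.StartSkewLE P) : σ.CompletionSkewLEOne P := by
  intro k hk p hp q hq τ τ' hτ hτ'
  obtain ⟨S, M, E, x, -, hE, -⟩ := exists_starts_completed hn hF hσ hk
  rw [completesAt_unique hτ (hE.completesAt p hp), completesAt_unique hτ' (hE.completesAt q hq)]
  exact hE.skew p hp q hq

end Scenario

end ByzSeq

theorem mainTheorem4 :
    ∃ C : ℕ, ∀ (V : Type*) [LinearOrder V] [Fintype V] [Nonempty V]
      (n t Δ ell : ℕ), 3 * t < n → 1 ≤ Δ →
      ∀ σ : ByzSeq.Scenario n V, σ.faulty.card ≤ t → σ.StartSkewLE ⟨t, Δ, ell⟩ →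
        σ.TerminatesWithin ⟨t, Δ, ell⟩ (C * (Δ * (ell + t))) ∧
        σ.Agreement ⟨t, Δ, ell⟩ ∧
        σ.Validity ⟨t, Δ, ell⟩ ∧
        σ.CompletionSkewLEOne ⟨t, Δ, ell⟩ := by
  -- An instance costs `Δ + 1 + 9 * (2 * Δ + 1) = 19 * Δ + 10`, which is at most `29 * Δ` because `1
  -- ≤ Δ`; an exposed node costs only `6 * Δ + 3`.
  refine ⟨29, fun V _ _ _ n t Δ ell hn hΔ σ hF hσ => ⟨fun p hp τ hτ => ?_,
    ByzSeq.Scenario.agreement hn hF hσ, ByzSeq.Scenario.validity hn hF hσ,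
    ByzSeq.Scenario.completionSkewLEOne hn hF hσ⟩⟩
  refine ByzSeq.Scenario.terminatesWithin hn hF hσ p hp τ (le_trans (Nat.add_le_add_right ?_ _) hτ)
  change ell * (Δ + 1 + 9 * (2 * Δ + 1)) + 3 * (2 * Δ + 1) * t ≤ _
  have h1 := Nat.mul_le_mul_left ell (show Δ + 1 + 9 * (2 * Δ + 1) ≤ 29 * Δ by omega)
  have h2 := Nat.mul_le_mul_right t (show 3 * (2 * Δ + 1) ≤ 29 * Δ by omega)
  calc _ ≤ ell * (29 * Δ) + 29 * Δ * t := add_le_add h1 h2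
    _ = 29 * (Δ * (ell + t)) := by ring
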